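/- **Conventions.** Indices are programs for partial recursive functions in a fixed effective numbering. Fix effective enumerations $(q_n)_{n\in\mathbb N}$ of $\mathbb{Q}$ and $(I_i)_{i\in\mathbb N}$ of the open intervals of $\mathbb{R}$ with rational endpoints. - A *Cauchy name* of $x\in\mathbb{R}$ is a sequence $(r_n)$ of rationals with $r_n\to x$ and $|r_n-r_{n+1}|<2^{-n}$ for all $n$. An *index* of $x$ is an index of a computable Cauchy name of $x$; $x$ is *computable* if it has an index. - An index of an open set $U\subseteq\mathbb{R}$ is an index of $\{i : I_i\subseteq U\}$ as a c.e. set; $U$ is $\Sigma^0_1$ if it has an index. - An index of a function $f:\mathbb{R}\to\mathbb{R}$ is an index of a Turing functional that maps every Cauchy name of any $x\in\mathbb{R}$ to a Cauchy name of $f(x)$; $f$ is *computable* if it has an index. - A finite Borel measure $\mu$ on $\mathbb{R}$ is *computable* if $\mu(\mathbb{R})$ is a computable real and from an index of a $\Sigma^0_1$ set $U$ one can compute an index of the c.e. set $\{n : q_n<\mu(U)\}$ (the left Dedekind cut of $\mu(U)$). Here "from $a$ one can compute $b$" means that one partial recursive function, fixed for the given $\mu$, is defined on every admissible input $a$ and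 has such a $b$ as its value there. **Proposition.** For every finite Borel measure $\mu$ on $\mathbb{R}$ the following are equivalent. 1. $\mu$ is computable. 2. $f\mapsto\int_{\mathbb{R}}f\,d\mu$ is computable on the nonnegative bounded computable functions $f:\mathbb{R}\to\mathbb{R}$: from an index of such an $f$ and any bound $B\in\mathbb{N}$ on $|f|$ one can compute an index of $\int_{\mathbb{R}} f\,d\mu$. 3. $f\mapsto\int_{\mathbb{R}}f\,d\mu$ is computable on the uniformly continuous computable functions $f:\mathbb{R}\to\mathbb{R}$ with $0\le f\le 1$: from an index of such an $f$ one can compute an index of $\int_{\mathbb{R}} f\,d\mu$. -/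

import Mathlib

open MeasureTheory Filter Topology

namespace CompMeasure

open Nat.Partrec (Code)

/-! Programs (`Nat.Partrec.Code`) serve as indices. "From an index of `A` one can compute an index
of `B`" means: there is a partial recursive function on programs which is defined on every index
of every admissible `A` and whose value there is an index of the corresponding `B`. -/

/-- An effective enumeration of the rationals: `⟨⟨a, b⟩, c⟩ ↦ (a - b) / (c + 1)`. -/
def ratOfNat (n : ℕ) : ℚ :=
  ((n.unpair.1.unpair.1 : ℚ) - (n.unpair.1.unpair.2 : ℚ)) / ((n.unpair.2 : ℚ) + 1)

/-- The effective enumeration `I_i` of the open intervals with rational endpoints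
(`⟨a, b⟩` with `q_b ≤ q_a` gives the empty interval). -/
def ratInterval (i : ℕ) : Set ℝ :=
  Set.Ioo (ratOfNat i.unpair.1 : ℝ) (ratOfNat i.unpair.2 : ℝ)

/-- Every rational number is enumerated. -/
theorem ratOfNat_surjective : Function.Surjective ratOfNat := by
  intro q
  refine ⟨Nat.pair (Nat.pair q.num.toNat (-q.num).toNat) (q.den - 1), ?_⟩
  have hz : ((q.num.toNat : ℤ) - ((-q.num).toNat : ℤ)) = q.num := by omega
  have h1 : ((q.num.toNat : ℚ) - ((-q.num).toNat : ℚ)) = (q.num : ℚ) := by exact_mod_cast hz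
  have h2 : (((q.den - 1 : ℕ) : ℚ) + 1) = (q.den : ℚ) := by
    have : q.den - 1 + 1 = q.den := Nat.sub_add_cancel q.pos
    exact_mod_cast this
  simp only [ratOfNat, Nat.unpair_pair]
  rw [h1, h2, Rat.num_div_den]

/-- `p` is a Cauchy name of `x`: the rationals `q_n` coded by `p n` converge to `x` and satisfy
`|q_n - q_{n+1}| < 2^{-n}`. -/
def IsCauchyName (p : ℕ → ℕ) (x : ℝ) : Prop :=
  Tendsto (fun n => (ratOfNat (p n) : ℝ)) atTop (𝓝 x) ∧
    ∀ n, |ratOfNat (p n) - ratOfNat (p (n + 1))| < (1 / 2 : ℚ) ^ n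

/-- `d` is an index of the real `x`: it computes a Cauchy name of `x`. -/
def IsRealIndex (d : Code) (x : ℝ) : Prop :=
  ∃ p : ℕ → ℕ, (∀ n, p n ∈ d.eval n) ∧ IsCauchyName p x

/-- `x` is a computable real. -/
def IsComputableReal (x : ℝ) : Prop := ∃ d : Code, IsRealIndex d x

/-- `d` is an index of the left Dedekind cut of `x`, as a c.e. set (the domain of `d`). -/
def IsLeftCutIndex (d : Code) (x : ℝ) : Prop :=
  ∀ n, (d.eval n).Dom ↔ (ratOfNat n : ℝ) < x

/-- `e` is an index of the `Σ⁰₁` open set `U`, i.e. of the c.e. set `{i | I_i ⊆ U}`. -/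
def IsSigmaIndex (e : Code) (U : Set ℝ) : Prop :=
  IsOpen U ∧ ∀ i, (e.eval i).Dom ↔ ratInterval i ⊆ U

/-- One step of the oracle machine `c`: run the program `c` on the first `k` symbols of the
oracle `ρ` and the argument `n`. Result `0` asks for the next oracle symbol, `m + 1` means that
the machine halts with output `m`. -/
def oracleStep (c : Code) (ρ : ℕ → ℕ) (n k : ℕ) : Part ℕ :=
  c.eval (Nat.pair (Encodable.encode ((List.range k).map ρ)) n)

/-- The Turing functional with program `c`, as an oracle machine that reads its oracle `ρ`
symbol by symbol: it reads on until a step halts, and then outputs the result. Since a machine may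
ask for any finite number of symbols, it has access to every value of `ρ`. -/
def turingFunctional (c : Code) (ρ : ℕ → ℕ) : ℕ →. ℕ := fun n =>
  (Nat.rfind fun k => (oracleStep c ρ n k).map fun a => decide (a ≠ 0)).bind fun k =>
    (oracleStep c ρ n k).map Nat.pred

/-- `e` is an index of the (computable) function `f : ℝ → ℝ`: the Turing functional `e` maps every
Cauchy name of any `x` to a Cauchy name of `f x`. -/
def IsFunctionIndex (e : Code) (f : ℝ → ℝ) : Prop :=
  ∀ (x : ℝ) (p : ℕ → ℕ), IsCauchyName p x →
    ∃ r : ℕ → ℕ, (∀ n, r n ∈ turingFunctional e p n) ∧ IsCauchyName r (f x)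

/-- `μ` is computable: `μ(ℝ)` is a computable real, and from an index of a `Σ⁰₁` open set `U` one
can compute an index of the left Dedekind cut of `μ(U)`. -/
def IsComputableMeasure (μ : Measure ℝ) : Prop :=
  IsComputableReal (μ.real Set.univ) ∧
    ∃ φ : Code →. Code, Partrec φ ∧
      ∀ (e : Code) (U : Set ℝ), IsSigmaIndex e U →
        ∃ d ∈ φ e, IsLeftCutIndex d (μ.real U)

/-- From an index of a nonnegative bounded computable `f` and a bound `B ∈ ℕ` on `|f|` one can
compute an index of `∫ f dμ`. -/
def IntegralComputableOnBounded (μ : Measure ℝ) : Prop :=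
  ∃ φ : Code × ℕ →. Code, Partrec φ ∧
    ∀ (e : Code) (f : ℝ → ℝ) (B : ℕ), IsFunctionIndex e f →
      (∀ x, 0 ≤ f x) → (∀ x, |f x| ≤ (B : ℝ)) →
        ∃ d ∈ φ (e, B), IsRealIndex d (∫ x, f x ∂μ)

/-- From an index of a uniformly continuous computable `f` with `0 ≤ f ≤ 1` one can compute an
index of `∫ f dμ`. -/
def IntegralComputableOnUnifCont (μ : Measure ℝ) : Prop :=
  ∃ φ : Code →. Code, Partrec φ ∧
    ∀ (e : Code) (f : ℝ → ℝ), IsFunctionIndex e f → UniformContinuous f →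
      (∀ x, 0 ≤ f x ∧ f x ≤ 1) →
        ∃ d ∈ φ e, IsRealIndex d (∫ x, f x ∂μ)

end CompMeasure

/-!
The three notions are compared by showing that integrals and measures of open sets can be searched
for from one another.

From the measure to integrals. A halting run of the functional of `f` at precision `n` reads only
finitely many symbols of a name, so its output is within `2 ^ (1 - n)` of `f` on a whole ball, and
these balls cover the line (`IsFunctionIndex.abs_sub_le_of_haltsWith`,
`IsFunctionIndex.exists_haltsWith`). By compactness, Lebesgue's number lemma and the disjointness of
shifted grids, finitely many disjoint cells of a rational grid, each inside such a ball, carry all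
of the measure up to `ε` (`exists_grid`). If `v j` approximates `f` on the cell `I j` and `m j` is a
rational below `μ (I j)`, then `∑ v j * m j` approximates `∫ f dμ` as soon as `∑ m j` is close to
`μ(ℝ)` (`abs_sum_sub_integral_le`). All of this is recursively enumerable, since `μ(ℝ)` is
computable and the cells have left-c.e. measures; hence suitable data can be found by search
(`exists_partrec_choice`).

Only the measures of single rational intervals enter here. This matters: an index of an open set `U`
enumerates *all* rational open intervals contained in `U`, and for a set such as `{x | t < f x}`
this set of intervals need not be recursively enumerable, whereas containment between rational
intervals is decidable (`exists_computable_isSigmaIndex`).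

From integrals to the measure. An index of `U` yields Lipschitz functions `stageFun e s s` with
values in `[0, 1]`, uniformly computable in the stage `s`, which vanish off `U` and converge to `1`
on `U`. Their integrals are at most `μ(U)` and converge to it, so `q < μ(U)` is confirmed by
approximating one of them well enough. The total mass is the integral of the constant `1`.
-/

namespace CompMeasure

open Nat.Partrec (Code)

/-! ### Recursively enumerable predicates -/

section Computability

variable {α β : Type*} [Primcodable α] [Primcodable β]

/-- The `s`-`m`-`n` theorem for parameters in an arbitrary `Primcodable` type. -/
theorem exists_computable_code {f : α → ℕ →. ℕ} (hf : Partrec₂ f) :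
    ∃ g : α → Code, Computable g ∧ ∀ a, (g a).eval = f a := by
  obtain ⟨c, hc⟩ := Code.exists_code.1 hf
  refine ⟨fun a => Code.curry c (Encodable.encode a),
    (Code.primrec₂_curry.to_comp).comp (Computable.const c) Computable.encode, fun a => ?_⟩
  funext n
  rw [Code.eval_curry, hc]
  simp [Encodable.decode_prod_val, Part.map_id']

/-- A recursively enumerable predicate is the increasing union of uniformly decidable stages. -/
theorem exists_stages {p : α → Prop} (hp : REPred p) :
    ∃ q : α × ℕ → Bool, Computable q ∧ (∀ a, p a ↔ ∃ s, q (a, s) = true) ∧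
      ∀ a s t, s ≤ t → q (a, s) = true → q (a, t) = true := by
  obtain ⟨c, hc⟩ := Code.exists_code.1 hp
  refine ⟨fun x => (Code.evaln x.2 c (Encodable.encode x.1)).isSome, ?_, fun a => ?_, ?_⟩
  · exact (Primrec.option_isSome.comp (Code.primrec_evaln.comp
      ((Primrec.snd.pair (Primrec.const c)).pair (Primrec.encode.comp Primrec.fst)))).to_comp
  · have h : (c.eval (Encodable.encode a)).Dom ↔ p a := by rw [hc]; simp [Part.assert]
    rw [← h]
    constructor
    · intro hd
      obtain ⟨s, hs⟩ := Code.evaln_complete.1 (Part.get_mem hd)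
      exact ⟨s, Option.isSome_iff_exists.2 ⟨_, hs⟩⟩
    · rintro ⟨s, hs⟩
      obtain ⟨x, hx⟩ := Option.isSome_iff_exists.1 hs
      exact Part.dom_iff_mem.2 ⟨x, Code.evaln_sound hx⟩
  · intro a s t hst h
    obtain ⟨x, hx⟩ := Option.isSome_iff_exists.1 h
    exact Option.isSome_iff_exists.2 ⟨x, Code.evaln_mono hst hx⟩

/-- Effective choice: a witness for a recursively enumerable relation can be found by search. -/
theorem exists_partrec_choice {R : α × β → Prop} (hR : REPred R) :
    ∃ g : α →. β, Partrec g ∧ ∀ a, (∃ b, R (a, b)) → ∃ b ∈ g a, R (a, b) := by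
  obtain ⟨q, hq, hqR, -⟩ := exists_stages hR
  let F : α → ℕ → Option β := fun a t =>
    (Encodable.decode (α := β × ℕ) t).bind fun y => bif q ((a, y.1), y.2) then some y.1 else none
  have hF : Computable₂ F := by
    refine Computable.option_bind (Computable.decode.comp Computable.snd) ?_
    refine Computable.cond (hq.comp ?_) ?_ (Computable.const none)
    · exact ((Computable.fst.comp Computable.fst).pair (Computable.fst.comp Computable.snd)).pair
        (Computable.snd.comp Computable.snd)
    · exact Computable.option_some.comp (Computable.fst.comp Computable.snd)
  have hsound : ∀ a t b, b ∈ F a t → R (a, b) := by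
    intro a t b hb
    obtain ⟨y, hy, hb⟩ := Option.bind_eq_some_iff.1 hb
    cases h : q ((a, y.1), y.2)
    · simp [h] at hb
    · simp only [h, cond_true, Option.some.injEq] at hb
      subst hb
      exact (hqR _).2 ⟨_, h⟩
  refine ⟨fun a => Nat.rfindOpt (F a), Partrec.rfindOpt hF, ?_⟩
  rintro a ⟨b, hb⟩
  obtain ⟨s, hs⟩ := (hqR _).1 hb
  have hd : (Nat.rfindOpt (F a)).Dom := Nat.rfindOpt_dom.2
    ⟨Encodable.encode (b, s), b, by simp [F, hs]⟩
  obtain ⟨t, ht⟩ := Nat.rfindOpt_spec (Part.get_mem hd)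
  exact ⟨_, Part.get_mem hd, hsound a t _ ht⟩

theorem rePred_of_computable {q : α → Bool} (hq : Computable q) :
    REPred fun a => q a = true :=
  ComputablePred.to_re ⟨inferInstance, by simpa using hq⟩

theorem rePred_exists {p : α × β → Prop} (hp : REPred p) : REPred fun a => ∃ b, p (a, b) := by
  obtain ⟨g, hg, hgp⟩ := exists_partrec_choice hp
  have h : REPred fun a : α => ∃ b ∈ g a, p (a, b) := by
    have h1 : Partrec fun a : α =>
        (g a).bind fun b => Part.assert (p (a, b)) fun _ => Part.some () :=
      Partrec.bind hg hp
    refine h1.dom_re.of_eq fun a => ?_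
    rw [Part.dom_iff_mem]
    simp [Part.assert, Part.mem_bind_iff]
  exact h.of_eq fun a => ⟨fun ⟨b, _, hb⟩ => ⟨b, hb⟩, fun hb => hgp a hb⟩

theorem rePred_and {p r : α → Prop} (hp : REPred p) (hr : REPred r) :
    REPred fun a => p a ∧ r a := by
  have h := Partrec.bind hp (Partrec.comp hr (Computable.fst (α := α) (β := Unit))).to₂
  refine h.dom_re.of_eq fun a => ?_
  simp [Part.assert, Part.bind_dom]

theorem rePred_forall_lt {p : α × ℕ → Prop} (hp : REPred p) {n : α → ℕ} (hn : Computable n) :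
    REPred fun a => ∀ j < n a, p (a, j) := by
  obtain ⟨q, hq, hqp, hmono⟩ := exists_stages hp
  let Q : α × ℕ → Bool := fun x => Nat.rec true (fun j b => b && q ((x.1, j), x.2)) (n x.1)
  have hQ : Computable Q := by
    suffices hstep : Computable₂ fun (x : α × ℕ) (y : ℕ × Bool) => y.2 && q ((x.1, y.1), x.2) from
      Computable.nat_rec (hn.comp Computable.fst) (Computable.const true) hstep
    refine Primrec.and.to_comp.comp (Computable.snd.comp Computable.snd) (hq.comp ?_)
    exact ((Computable.fst.comp Computable.fst).pair (Computable.fst.comp Computable.snd)).pair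
      (Computable.snd.comp Computable.fst)
  have hQs : ∀ a s, Q (a, s) = true ↔ ∀ j < n a, q ((a, j), s) = true := by
    intro a s
    change Nat.rec true (fun j b => b && q ((a, j), s)) (n a) = true ↔ _
    generalize n a = m
    induction m with
    | zero => simp
    | succ m ih => rw [Nat.forall_lt_succ_right, ← ih]; simp
  refine (rePred_exists (rePred_of_computable hQ)).of_eq fun a => ?_
  simp only [hQs, hqp]
  constructor
  · rintro ⟨s, hs⟩ j hj
    exact ⟨s, hs j hj⟩
  · intro h
    have h' : ∀ j, ∃ s, j < n a → q ((a, j), s) = true := fun j => by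
      by_cases hj : j < n a
      · obtain ⟨s, hs⟩ := h j hj
        exact ⟨s, fun _ => hs⟩
      · exact ⟨0, fun hj' => absurd hj' hj⟩
    choose s hs using h'
    exact ⟨(Finset.range (n a)).sup s, fun j hj =>
      hmono _ _ _ (Finset.le_sup (Finset.mem_range.2 hj)) (hs j hj)⟩

theorem rePred_dom {f : α →. β} (hf : Partrec f) : REPred fun a => (f a).Dom :=
  hf.dom_re

theorem rePred_mem {f : α →. β} (hf : Partrec f) {g : α → β} (hg : Computable g) :
    REPred fun a => g a ∈ f a := by
  have hm : Partrec fun a => (f a).map fun b =>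
        decide (Encodable.encode b = Encodable.encode (g a)) := by
    refine hf.map ?_
    exact (Primrec.eq (α := ℕ)).decide.to_comp.comp (Computable.encode.comp Computable.snd)
      (Computable.encode.comp (hg.comp Computable.fst))
  have h := Partrec.bind hm (g := fun (_ : α) (b : Bool) =>
      ((if b then some () else none : Option Unit) : Part Unit))
    (Computable.ofOption
      ((Primrec.dom_bool fun b => if b then some () else none).to_comp.comp Computable.snd))
  refine (rePred_dom h).of_eq fun a => ?_
  rw [Part.dom_iff_mem]
  constructor
  · rintro ⟨_, hy⟩
    obtain ⟨b, hb, hy⟩ := Part.mem_bind_iff.1 hy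
    obtain ⟨c, hc, rfl⟩ := (Part.mem_map_iff _).1 hb
    by_cases h : c = g a
    · exact h ▸ hc
    · simp [h] at hy
  · intro h
    exact ⟨(), Part.mem_bind_iff.2 ⟨true, (Part.mem_map_iff _).2 ⟨_, h, by simp⟩, by simp⟩⟩

/-- The `s`-`m`-`n` theorem for recursively enumerable sets, given as domains of programs. -/
theorem exists_computable_code_dom {p : α × ℕ → Prop} (hp : REPred p) :
    ∃ g : α → Code, Computable g ∧ ∀ a n, ((g a).eval n).Dom ↔ p (a, n) := by
  have h : Partrec₂ fun (a : α) (n : ℕ) =>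
      (Part.assert (p (a, n)) fun _ => Part.some ()).map fun _ => 0 :=
    Partrec.map hp ((Computable.const 0).to₂)
  obtain ⟨g, hg, hgp⟩ := exists_computable_code h
  exact ⟨g, hg, fun a n => by rw [hgp]; simp [Part.assert]⟩

end Computability

/-! ### Rational arithmetic on codes -/

/-- The code of `(a - b) / (c + 1)`. -/
def mkC (a b c : ℕ) : ℕ := Nat.pair (Nat.pair a b) c

theorem ratOfNat_mkC (a b c : ℕ) : ratOfNat (mkC a b c) = ((a : ℚ) - b) / (c + 1) := by
  simp [ratOfNat, mkC]

/-- The positive part `a` of the numerator in the code of `(a - b) / (c + 1)`. -/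
def posC (x : ℕ) : ℕ := x.unpair.1.unpair.1

/-- The negative part `b` of the numerator in the code of `(a - b) / (c + 1)`. -/
def negC (x : ℕ) : ℕ := x.unpair.1.unpair.2

/-- The denominator `c + 1` in the code of `(a - b) / (c + 1)`. -/
def denC (x : ℕ) : ℕ := x.unpair.2 + 1

theorem ratOfNat_eq (x : ℕ) : ratOfNat x = ((posC x : ℚ) - negC x) / denC x := by
  simp [ratOfNat, posC, negC, denC]

theorem denC_pos (x : ℕ) : (0 : ℚ) < denC x := by
  simp only [denC]; positivity

/-- Addition of rationals on codes. -/
def addC (x y : ℕ) : ℕ :=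
  mkC (posC x * denC y + posC y * denC x) (negC x * denC y + negC y * denC x)
    (denC x * denC y - 1)

/-- Negation of rationals on codes. -/
def negateC (x : ℕ) : ℕ := mkC (negC x) (posC x) (denC x - 1)

/-- Multiplication of rationals on codes. -/
def mulC (x y : ℕ) : ℕ :=
  mkC (posC x * posC y + negC x * negC y) (posC x * negC y + negC x * posC y)
    (denC x * denC y - 1)

/-- The decision of `<` between rationals on codes. -/
def ltC (x y : ℕ) : Bool :=
  decide (posC x * denC y + negC y * denC x < posC y * denC x + negC x * denC y)

/-- The minimum of rationals on codes. -/
def minC (x y : ℕ) : ℕ := bif ltC x y then x else y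

/-- The maximum of rationals on codes. -/
def maxC (x y : ℕ) : ℕ := bif ltC x y then y else x

/-- The code of a natural number. -/
def natC (n : ℕ) : ℕ := mkC n 0 0

/-- The code of `2 ^ (-n)`. -/
def halfPowC (n : ℕ) : ℕ := mkC 1 0 (2 ^ n - 1)

theorem cast_sub_one_add_one {m : ℕ} (hm : 0 < m) : ((m - 1 : ℕ) : ℚ) + 1 = m := by
  exact_mod_cast Nat.sub_add_cancel hm

theorem mul_denC_pos (x y : ℕ) : 0 < denC x * denC y :=
  Nat.mul_pos (Nat.succ_pos _) (Nat.succ_pos _)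

theorem ratOfNat_addC (x y : ℕ) : ratOfNat (addC x y) = ratOfNat x + ratOfNat y := by
  have hx := denC_pos x
  have hy := denC_pos y
  rw [addC, ratOfNat_mkC, cast_sub_one_add_one (mul_denC_pos x y),
    ratOfNat_eq x, ratOfNat_eq y]
  push_cast
  field_simp
  ring

theorem ratOfNat_negateC (x : ℕ) : ratOfNat (negateC x) = -ratOfNat x := by
  rw [negateC, ratOfNat_mkC, cast_sub_one_add_one (m := denC x) (Nat.succ_pos _), ratOfNat_eq x]
  ring

theorem ratOfNat_mulC (x y : ℕ) : ratOfNat (mulC x y) = ratOfNat x * ratOfNat y := by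
  have hx := denC_pos x
  have hy := denC_pos y
  rw [mulC, ratOfNat_mkC, cast_sub_one_add_one (mul_denC_pos x y),
    ratOfNat_eq x, ratOfNat_eq y]
  push_cast
  field_simp
  ring

theorem ltC_iff (x y : ℕ) : ltC x y = true ↔ ratOfNat x < ratOfNat y := by
  rw [ltC, decide_eq_true_iff, ratOfNat_eq x, ratOfNat_eq y,
    div_lt_div_iff₀ (denC_pos x) (denC_pos y), ← Nat.cast_lt (α := ℚ)]
  push_cast
  constructor <;> intro h <;> linarith

theorem ratOfNat_minC (x y : ℕ) : ratOfNat (minC x y) = min (ratOfNat x) (ratOfNat y) := by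
  have h := ltC_iff x y
  unfold minC
  cases hl : ltC x y
  · rw [hl] at h
    rw [cond_false, min_eq_right (not_lt.1 fun h' => by simpa using h.2 h')]
  · rw [cond_true, min_eq_left (h.1 hl).le]

theorem ratOfNat_maxC (x y : ℕ) : ratOfNat (maxC x y) = max (ratOfNat x) (ratOfNat y) := by
  have h := ltC_iff x y
  unfold maxC
  cases hl : ltC x y
  · rw [hl] at h
    rw [cond_false, max_eq_left (not_lt.1 fun h' => by simpa using h.2 h')]
  · rw [cond_true, max_eq_right (h.1 hl).le]

theorem ratOfNat_natC (n : ℕ) : ratOfNat (natC n) = n := by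
  simp [natC, ratOfNat_mkC]

theorem ratOfNat_halfPowC (n : ℕ) : ratOfNat (halfPowC n) = (1 / 2 : ℚ) ^ n := by
  rw [halfPowC, ratOfNat_mkC, cast_sub_one_add_one (by positivity)]
  simp

theorem primrec_posC : Primrec posC :=
  Primrec.fst.comp (Primrec.unpair.comp (Primrec.fst.comp Primrec.unpair))

theorem primrec_negC : Primrec negC :=
  Primrec.snd.comp (Primrec.unpair.comp (Primrec.fst.comp Primrec.unpair))

theorem primrec_denC : Primrec denC :=
  Primrec.succ.comp (Primrec.snd.comp Primrec.unpair)

section Primrec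

variable {α : Type*} [Primcodable α] {f g h : α → ℕ}

theorem primrec_mkC (hf : Primrec f) (hg : Primrec g) (hh : Primrec h) :
    Primrec fun a => mkC (f a) (g a) (h a) :=
  Primrec₂.natPair.comp (Primrec₂.natPair.comp hf hg) hh

theorem primrec_addC (hf : Primrec f) (hg : Primrec g) : Primrec fun a => addC (f a) (g a) := by
  have pf := primrec_posC.comp hf
  have nf := primrec_negC.comp hf
  have df := primrec_denC.comp hf
  have pg := primrec_posC.comp hg
  have ng := primrec_negC.comp hg
  have dg := primrec_denC.comp hg
  exact primrec_mkC
    (Primrec.nat_add.comp (Primrec.nat_mul.comp pf dg) (Primrec.nat_mul.comp pg df))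
    (Primrec.nat_add.comp (Primrec.nat_mul.comp nf dg) (Primrec.nat_mul.comp ng df))
    (Primrec.pred.comp (Primrec.nat_mul.comp df dg))

theorem primrec_negateC (hf : Primrec f) : Primrec fun a => negateC (f a) :=
  primrec_mkC (primrec_negC.comp hf) (primrec_posC.comp hf)
    (Primrec.pred.comp (primrec_denC.comp hf))

theorem primrec_mulC (hf : Primrec f) (hg : Primrec g) : Primrec fun a => mulC (f a) (g a) := by
  have pf := primrec_posC.comp hf
  have nf := primrec_negC.comp hf
  have df := primrec_denC.comp hf
  have pg := primrec_posC.comp hg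
  have ng := primrec_negC.comp hg
  have dg := primrec_denC.comp hg
  exact primrec_mkC
    (Primrec.nat_add.comp (Primrec.nat_mul.comp pf pg) (Primrec.nat_mul.comp nf ng))
    (Primrec.nat_add.comp (Primrec.nat_mul.comp pf ng) (Primrec.nat_mul.comp nf pg))
    (Primrec.pred.comp (Primrec.nat_mul.comp df dg))

theorem primrec_ltC (hf : Primrec f) (hg : Primrec g) : Primrec fun a => ltC (f a) (g a) := by
  have pf := primrec_posC.comp hf
  have nf := primrec_negC.comp hf
  have df := primrec_denC.comp hf
  have pg := primrec_posC.comp hg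
  have ng := primrec_negC.comp hg
  have dg := primrec_denC.comp hg
  exact Primrec.nat_lt.decide.comp
    (Primrec.nat_add.comp (Primrec.nat_mul.comp pf dg) (Primrec.nat_mul.comp ng df))
    (Primrec.nat_add.comp (Primrec.nat_mul.comp pg df) (Primrec.nat_mul.comp nf dg))

theorem primrec_minC (hf : Primrec f) (hg : Primrec g) : Primrec fun a => minC (f a) (g a) :=
  Primrec.cond (primrec_ltC hf hg) hf hg

theorem primrec_maxC (hf : Primrec f) (hg : Primrec g) : Primrec fun a => maxC (f a) (g a) :=
  Primrec.cond (primrec_ltC hf hg) hg hf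

theorem primrec_natC (hf : Primrec f) : Primrec fun a => natC (f a) :=
  primrec_mkC hf (Primrec.const 0) (Primrec.const 0)

theorem primrec_two_pow (hf : Primrec f) : Primrec fun a => 2 ^ f a := by
  have h : Primrec₂ ((· ^ ·) : ℕ → ℕ → ℕ) := Primrec₂.unpaired'.1 Nat.Primrec.pow
  exact h.comp (Primrec.const 2) hf

theorem primrec_halfPowC (hf : Primrec f) : Primrec fun a => halfPowC (f a) :=
  primrec_mkC (Primrec.const 1) (Primrec.const 0) (Primrec.pred.comp (primrec_two_pow hf))

/-- The sum of the rationals coded by `t 0, …, t (n - 1)`. -/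
def sumC (t : ℕ → ℕ) : ℕ → ℕ
  | 0 => natC 0
  | n + 1 => addC (sumC t n) (t n)

theorem ratOfNat_sumC (t : ℕ → ℕ) (n : ℕ) :
    ratOfNat (sumC t n) = ∑ j ∈ Finset.range n, ratOfNat (t j) := by
  induction n with
  | zero => simp [sumC, ratOfNat_natC]
  | succ n ih => rw [sumC, ratOfNat_addC, ih, Finset.sum_range_succ]

theorem primrec_sumC {t : α → ℕ → ℕ} (ht : Primrec₂ t) {n : α → ℕ} (hn : Primrec n) :
    Primrec fun a => sumC (t a) (n a) := by
  have hstep : Primrec₂ fun (a : α) (y : ℕ × ℕ) => addC y.2 (t a y.1) :=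
    primrec_addC (Primrec.snd.comp Primrec.snd)
      (ht.comp Primrec.fst (Primrec.fst.comp Primrec.snd))
  refine (Primrec.nat_rec' hn (Primrec.const (natC 0)) hstep).of_eq fun a => ?_
  generalize n a = m
  induction m with
  | zero => rfl
  | succ m ih => simp only [sumC, ← ih]

end Primrec

/-! ### Cauchy names and Turing functionals -/

theorem abs_sub_lt_half_pow_iff (a b : ℚ) (n : ℕ) :
    |a - b| < (1 / 2 : ℚ) ^ n ↔ |(a : ℝ) - b| < (1 / 2) ^ n := by
  rw [← Rat.cast_lt (K := ℝ)]
  push_cast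
  rfl

theorem IsCauchyName.abs_sub_le {p : ℕ → ℕ} {x : ℝ} (h : IsCauchyName p x) (n : ℕ) :
    |(ratOfNat (p n) : ℝ) - x| ≤ 2 * (1 / 2) ^ n := by
  have h2 : ∀ n, dist (ratOfNat (p n) : ℝ) (ratOfNat (p (n + 1))) ≤ 2 / 2 / 2 ^ n := by
    intro n
    rw [Real.dist_eq]
    have h3 := (abs_sub_lt_half_pow_iff _ _ _).1 (h.2 n)
    rw [div_self two_ne_zero]
    simpa using h3.le
  have := dist_le_of_le_geometric_two_of_tendsto h2 h.1 n
  rw [Real.dist_eq] at this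
  simpa [div_eq_mul_inv] using this

theorem exists_code_abs_sub_lt (x : ℝ) {ε : ℝ} (hε : 0 < ε) :
    ∃ r : ℕ, |(ratOfNat r : ℝ) - x| < ε := by
  obtain ⟨q, hq1, hq2⟩ := exists_rat_btwn (show x - ε < x + ε by linarith)
  obtain ⟨r, rfl⟩ := ratOfNat_surjective q
  exact ⟨r, abs_lt.2 ⟨by linarith, by linarith⟩⟩

theorem tendsto_of_abs_sub_le {u : ℕ → ℝ} {x : ℝ} (k : ℕ)
    (h : ∀ n, k ≤ n → |u n - x| ≤ (1 / 2) ^ (n + 2)) : Tendsto u atTop (𝓝 x) := by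
  rw [tendsto_iff_dist_tendsto_zero]
  have h0 : Tendsto (fun n : ℕ => (1 / 2 : ℝ) ^ (n + 2)) atTop (𝓝 0) :=
    (tendsto_add_atTop_iff_nat 2).2
      (tendsto_pow_atTop_nhds_zero_of_lt_one (by norm_num) (by norm_num))
  refine squeeze_zero' (Eventually.of_forall fun _ => dist_nonneg) ?_ h0
  filter_upwards [eventually_ge_atTop k] with n hn
  rw [Real.dist_eq]
  exact h n hn

theorem abs_sub_lt_of_close {a b x : ℝ} {n : ℕ} (ha : |a - x| ≤ (1 / 2) ^ (n + 2))
    (hb : |b - x| ≤ (1 / 2) ^ (n + 1 + 2)) : |a - b| < (1 / 2) ^ n := by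
  have hp : (0 : ℝ) < (1 / 2) ^ n := by positivity
  have h1 : (1 / 2 : ℝ) ^ (n + 2) = (1 / 2) ^ n / 4 := by ring
  have h2 : (1 / 2 : ℝ) ^ (n + 1 + 2) = (1 / 2) ^ n / 8 := by ring
  rw [h1] at ha
  rw [h2] at hb
  rw [abs_le] at ha hb
  rw [abs_lt]
  constructor <;> linarith [ha.1, ha.2, hb.1, hb.2]

theorem isCauchyName_of_abs_sub_le {p : ℕ → ℕ} {x : ℝ}
    (h : ∀ n, |(ratOfNat (p n) : ℝ) - x| ≤ (1 / 2) ^ (n + 2)) : IsCauchyName p x := by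
  refine ⟨tendsto_of_abs_sub_le 0 fun n _ => h n, fun n => ?_⟩
  exact (abs_sub_lt_half_pow_iff _ _ _).2 (abs_sub_lt_of_close (h n) (h (n + 1)))

/-- The symbols `ρ 0, …, ρ k` can start a Cauchy name. -/
def IsNamePrefix (ρ : ℕ → ℕ) (k : ℕ) : Prop :=
  ∀ i < k, |ratOfNat (ρ i) - ratOfNat (ρ (i + 1))| < (1 / 2 : ℚ) ^ i

/-- The points having a Cauchy name that starts with a given prefix fill a neighbourhood of the
last rational of that prefix. -/
theorem exists_isCauchyName_extending {ρ : ℕ → ℕ} {k : ℕ} (hρ : IsNamePrefix ρ k) {x : ℝ}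
    (hx : |(ratOfNat (ρ k) : ℝ) - x| < (1 / 2) ^ k) :
    ∃ p, IsCauchyName p x ∧ ∀ i ≤ k, p i = ρ i := by
  have hδ : 0 < (1 / 2 : ℝ) ^ k - |(ratOfNat (ρ k) : ℝ) - x| := by linarith
  have hs : ∀ i : ℕ, ∃ r : ℕ, |(ratOfNat r : ℝ) - x| <
      min ((1 / 2) ^ (i + 2)) ((1 / 2 : ℝ) ^ k - |(ratOfNat (ρ k) : ℝ) - x|) :=
    fun i => exists_code_abs_sub_lt x (lt_min (by positivity) hδ)
  choose s hs using hs
  have hs1 := fun i => (hs i).trans_le (min_le_left _ _)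
  have hs2 := fun i => (hs i).trans_le (min_le_right _ _)
  refine ⟨fun i => if i ≤ k then ρ i else s i, ⟨?_, fun n => ?_⟩, fun i hi => if_pos hi⟩
  · refine tendsto_of_abs_sub_le (k + 1) fun n hn => ?_
    beta_reduce
    rw [if_neg (by omega)]
    exact (hs1 n).le
  · beta_reduce
    rcases lt_trichotomy n k with h | rfl | h
    · rw [if_pos h.le, if_pos (by omega)]
      exact hρ n h
    · rw [if_pos le_rfl, if_neg (by omega)]
      have h1 := hs2 (n + 1)
      have h2 : |(ratOfNat (ρ n) : ℝ) - ratOfNat (s (n + 1))| < (1 / 2) ^ n := by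
        have h3 := abs_sub_le (ratOfNat (ρ n) : ℝ) x (ratOfNat (s (n + 1)))
        rw [abs_sub_comm x] at h3
        linarith
      exact (abs_sub_lt_half_pow_iff _ _ _).2 h2
    · rw [if_neg (by omega), if_neg (by omega)]
      exact (abs_sub_lt_half_pow_iff _ _ _).2
        (abs_sub_lt_of_close (hs1 n).le (hs1 (n + 1)).le)

/-- The oracle machine `e` with oracle `ρ` and input `n` reads exactly the first `k` symbols and
then halts with output `v`. -/
def HaltsWith (e : Code) (ρ : ℕ → ℕ) (n k v : ℕ) : Prop :=
  (∀ i < k, 0 ∈ oracleStep e ρ n i) ∧ v + 1 ∈ oracleStep e ρ n k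

theorem mem_turingFunctional {e : Code} {ρ : ℕ → ℕ} {n v : ℕ} :
    v ∈ turingFunctional e ρ n ↔ ∃ k, HaltsWith e ρ n k v := by
  unfold turingFunctional HaltsWith
  simp only [Part.mem_bind_iff, Part.mem_map_iff]
  constructor
  · rintro ⟨k, hk, b, hb, rfl⟩
    obtain ⟨hk, hlt⟩ := Nat.mem_rfind.1 hk
    obtain ⟨a, ha, ha0⟩ := (Part.mem_map_iff _).1 hk
    obtain rfl := Part.mem_unique ha hb
    refine ⟨k, fun i hi => ?_, ?_⟩
    · obtain ⟨c, hc, hc0⟩ := (Part.mem_map_iff _).1 (hlt hi)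
      have : c = 0 := by simpa using hc0
      exact this ▸ hc
    · have : a ≠ 0 := by simpa using ha0
      rwa [Nat.pred_eq_sub_one, Nat.sub_add_cancel (Nat.pos_of_ne_zero this)]
  · rintro ⟨k, hlt, hk⟩
    refine ⟨k, Nat.mem_rfind.2 ⟨?_, fun {i} hi => ?_⟩, _, hk, rfl⟩
    · exact (Part.mem_map_iff _).2 ⟨_, hk, by simp⟩
    · exact (Part.mem_map_iff _).2 ⟨_, hlt i hi, by simp⟩

theorem oracleStep_congr {ρ ρ' : ℕ → ℕ} {k : ℕ} (h : ∀ i < k, ρ i = ρ' i) (e : Code) (n : ℕ) :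
    oracleStep e ρ n k = oracleStep e ρ' n k := by
  unfold oracleStep
  rw [List.map_congr_left fun i hi => h i (List.mem_range.1 hi)]

theorem HaltsWith.congr {e : Code} {ρ ρ' : ℕ → ℕ} {n k v : ℕ} (hh : HaltsWith e ρ n k v)
    (h : ∀ i < k, ρ i = ρ' i) : HaltsWith e ρ' n k v := by
  refine ⟨fun i hi => ?_, ?_⟩
  · rw [← oracleStep_congr fun j hj => h j (hj.trans hi)]
    exact hh.1 i hi
  · rw [← oracleStep_congr h]
    exact hh.2

/-- A halting computation on a finite prefix determines `f` up to `2 ^ (1 - n)` on a whole ball. -/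
theorem IsFunctionIndex.abs_sub_le_of_haltsWith {e : Code} {f : ℝ → ℝ} (he : IsFunctionIndex e f)
    {ρ : ℕ → ℕ} {n k v : ℕ} (hρ : IsNamePrefix ρ k) (hv : HaltsWith e ρ n k v) {x : ℝ}
    (hx : |(ratOfNat (ρ k) : ℝ) - x| < (1 / 2) ^ k) :
    |(ratOfNat v : ℝ) - f x| ≤ 2 * (1 / 2) ^ n := by
  obtain ⟨p, hp, hpρ⟩ := exists_isCauchyName_extending hρ hx
  obtain ⟨r, hr, hrf⟩ := he x p hp
  have h1 : v ∈ turingFunctional e p n :=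
    mem_turingFunctional.2 ⟨k, hv.congr fun i hi => (hpρ i hi.le).symm⟩
  rw [Part.mem_unique h1 (hr n)]
  exact hrf.abs_sub_le n

/-- Every point lies in a ball on which a halting computation determines `f`. -/
theorem IsFunctionIndex.exists_haltsWith {e : Code} {f : ℝ → ℝ} (he : IsFunctionIndex e f)
    (x : ℝ) (n : ℕ) :
    ∃ ρ k v, IsNamePrefix ρ k ∧ HaltsWith e ρ n k v ∧
      |(ratOfNat (ρ k) : ℝ) - x| < (1 / 2) ^ k := by
  have hs : ∀ i : ℕ, ∃ r : ℕ, |(ratOfNat r : ℝ) - x| < (1 / 2) ^ (i + 2) :=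
    fun i => exists_code_abs_sub_lt x (by positivity)
  choose p hp using hs
  have hpx : IsCauchyName p x := isCauchyName_of_abs_sub_le fun n => (hp n).le
  obtain ⟨r, hr, -⟩ := he x p hpx
  obtain ⟨k, hk⟩ := mem_turingFunctional.1 (hr n)
  exact ⟨p, k, r n, fun i _ => hpx.2 i, hk, (hp k).trans_le
    (pow_le_pow_of_le_one (by norm_num) (by norm_num) (by omega))⟩

theorem IsFunctionIndex.continuous {e : Code} {f : ℝ → ℝ} (he : IsFunctionIndex e f) :
    Continuous f := by
  rw [continuous_iff_continuousAt]
  intro x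
  rw [Metric.continuousAt_iff']
  intro ε hε
  obtain ⟨n, hn⟩ := exists_pow_lt_of_lt_one (show 0 < ε / 4 by positivity)
    (show (1 / 2 : ℝ) < 1 by norm_num)
  obtain ⟨ρ, k, v, hρ, hv, hx⟩ := he.exists_haltsWith x n
  have hU : ∀ᶠ y in 𝓝 x, |(ratOfNat (ρ k) : ℝ) - y| < (1 / 2) ^ k :=
    (by fun_prop : Continuous fun y : ℝ => |(ratOfNat (ρ k) : ℝ) - y|).continuousAt.eventually_lt
      continuousAt_const hx
  filter_upwards [hU] with y hy
  have h1 := he.abs_sub_le_of_haltsWith hρ hv hx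
  have h2 := he.abs_sub_le_of_haltsWith hρ hv hy
  rw [Real.dist_eq]
  rw [abs_le] at h1 h2
  rw [abs_lt]
  constructor <;> linarith [h1.1, h1.2, h2.1, h2.2]

/-- Functionals that apply a computable map to one symbol of the oracle, uniformly in a
parameter. -/
theorem exists_computable_functional {α : Type*} [Primcodable α] {V : α → ℕ → ℕ}
    (hV : Computable₂ V) {m : α → ℕ} (hm : Computable m) :
    ∃ g : α → Code, Computable g ∧
      ∀ a ρ n, V a (ρ (n + m a)) ∈ turingFunctional (g a) ρ n := by
  let S : α → ℕ → ℕ := fun a y =>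
    Option.casesOn ((((Encodable.decode (α := List ℕ) y.unpair.1).getD [])[y.unpair.2 + m a]?))
      0 fun r => V a r + 1
  have hS : Computable₂ S := by
    have hL : Computable fun x : α × ℕ =>
        (Encodable.decode (α := List ℕ) x.2.unpair.1).getD [] :=
      Computable.option_getD (Computable.decode.comp
        (Computable.fst.comp (Computable.unpair.comp Computable.snd))) (Computable.const [])
    have hn : Computable fun x : α × ℕ => x.2.unpair.2 + m x.1 :=
      Primrec.nat_add.to_comp.comp (Computable.snd.comp (Computable.unpair.comp Computable.snd))
        (hm.comp Computable.fst)
    refine Computable.option_casesOn (Computable.list_getElem?.comp hL hn) (Computable.const 0) ?_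
    exact Computable.succ.comp (hV.comp (Computable.fst.comp Computable.fst) Computable.snd)
  obtain ⟨g, hg, hgS⟩ := exists_computable_code (f := fun a n => Part.some (S a n)) hS.partrec₂
  refine ⟨g, hg, fun a ρ n => mem_turingFunctional.2 ⟨n + m a + 1, fun i hi => ?_, ?_⟩⟩
  · unfold oracleStep
    rw [hgS, Part.mem_some_iff]
    simp [S, List.getElem?_eq_none (l := (List.range i).map ρ) (i := n + m a)
      (by simpa using (by omega : i ≤ n + m a))]
  · unfold oracleStep
    rw [hgS, Part.mem_some_iff]
    simp [S]

/-- If `V` computes a `2 ^ m`-Lipschitz `f` on the rationals, then reading the `(n + m)`-th symbol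
of a name of `x` suffices for the `n`-th symbol of a name of `f x`. -/
theorem isFunctionIndex_of_lipschitz {c : Code} {V : ℕ → ℕ} {m : ℕ}
    (hc : ∀ ρ n, V (ρ (n + m)) ∈ turingFunctional c ρ n) {f : ℝ → ℝ}
    (hf : ∀ x y, |f x - f y| ≤ 2 ^ m * |x - y|)
    (hV : ∀ r, (ratOfNat (V r) : ℝ) = f (ratOfNat r)) : IsFunctionIndex c f := by
  intro x p hp
  refine ⟨fun n => V (p (n + m)), fun n => hc p n, ?_, fun n => ?_⟩
  · have hcont : Continuous f := by
      refine (LipschitzWith.of_dist_le_mul (K := 2 ^ m) fun x y => ?_).continuous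
      simpa [Real.dist_eq] using hf x y
    simp only [hV]
    exact (hcont.tendsto x).comp (hp.1.comp (tendsto_add_atTop_nat m))
  · have h1 : |(ratOfNat (p (n + m)) : ℝ) - ratOfNat (p (n + 1 + m))| < (1 / 2) ^ (n + m) := by
      have := hp.2 (n + m)
      rw [show n + m + 1 = n + 1 + m by ring] at this
      exact (abs_sub_lt_half_pow_iff _ _ _).1 this
    have h2 : |(ratOfNat (V (p (n + m))) : ℝ) - ratOfNat (V (p (n + 1 + m)))| < (1 / 2) ^ n := by
      rw [hV, hV]
      calc _ ≤ 2 ^ m * |(ratOfNat (p (n + m)) : ℝ) - ratOfNat (p (n + 1 + m))| := hf _ _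
        _ < 2 ^ m * (1 / 2) ^ (n + m) := by gcongr
        _ = (1 / 2) ^ n := by
          rw [pow_add, mul_left_comm, ← mul_pow]
          norm_num
    exact (abs_sub_lt_half_pow_iff _ _ _).2 h2

/-! ### Open sets as limits of Lipschitz functions -/

/-- The trapezoid of slope `2 ^ s` and height at most `1` supported on the rational interval
`ratInterval i`. -/
noncomputable def trapezoid (i s : ℕ) (x : ℝ) : ℝ :=
  min 1 (max 0 (2 ^ s * min (x - ratOfNat i.unpair.1) (ratOfNat i.unpair.2 - x)))

/-- `trapezoid` on codes of rationals. -/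
def trapezoidC (i s r : ℕ) : ℕ :=
  minC (natC 1) (maxC (natC 0) (mulC (natC (2 ^ s))
    (minC (addC r (negateC i.unpair.1)) (addC i.unpair.2 (negateC r)))))

/-- The maximum of the trapezoids of slope `2 ^ s` on those of the intervals
`ratInterval 0, …, ratInterval (m - 1)` that the program `e` accepts within `s` steps. -/
noncomputable def stageFun (e : Code) (s : ℕ) : ℕ → ℝ → ℝ
  | 0, _ => 0
  | i + 1, x => bif (e.evaln s i).isSome then max (stageFun e s i x) (trapezoid i s x)
      else stageFun e s i x

/-- `stageFun` on codes of rationals. -/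
def stageFunC (e : Code) (s : ℕ) : ℕ → ℕ → ℕ
  | 0, _ => natC 0
  | i + 1, r => bif (e.evaln s i).isSome then maxC (stageFunC e s i r) (trapezoidC i s r)
      else stageFunC e s i r

theorem ratOfNat_trapezoidC (i s r : ℕ) :
    (ratOfNat (trapezoidC i s r) : ℝ) = trapezoid i s (ratOfNat r) := by
  simp only [trapezoidC, trapezoid, ratOfNat_minC, ratOfNat_maxC, ratOfNat_mulC, ratOfNat_addC,
    ratOfNat_negateC, ratOfNat_natC]
  push_cast
  simp [sub_eq_add_neg]

theorem ratOfNat_stageFunC (e : Code) (s m r : ℕ) :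
    (ratOfNat (stageFunC e s m r) : ℝ) = stageFun e s m (ratOfNat r) := by
  induction m with
  | zero => simp [stageFunC, stageFun, ratOfNat_natC]
  | succ m ih =>
    rw [stageFunC, stageFun]
    cases (e.evaln s m).isSome
    · simpa using ih
    · simp [ratOfNat_maxC, ih, ratOfNat_trapezoidC]

theorem primrec_stageFunC :
    Primrec fun x : (Code × ℕ) × ℕ => stageFunC x.1.1 x.1.2 x.1.2 x.2 := by
  have hi : Primrec fun y : ((Code × ℕ) × ℕ) × (ℕ × ℕ) => y.2.1 := Primrec.fst.comp Primrec.snd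
  have hr : Primrec fun y : ((Code × ℕ) × ℕ) × (ℕ × ℕ) => y.1.2 := Primrec.snd.comp Primrec.fst
  have hs : Primrec fun y : ((Code × ℕ) × ℕ) × (ℕ × ℕ) => y.1.1.2 :=
    Primrec.snd.comp (Primrec.fst.comp Primrec.fst)
  have he : Primrec fun y : ((Code × ℕ) × ℕ) × (ℕ × ℕ) => y.1.1.1 :=
    Primrec.fst.comp (Primrec.fst.comp Primrec.fst)
  have hv : Primrec fun y : ((Code × ℕ) × ℕ) × (ℕ × ℕ) => y.2.2 := Primrec.snd.comp Primrec.snd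
  have ht : Primrec fun y : ((Code × ℕ) × ℕ) × (ℕ × ℕ) => trapezoidC y.2.1 y.1.1.2 y.1.2 :=
    primrec_minC (Primrec.const _) (primrec_maxC (Primrec.const _)
      (primrec_mulC (primrec_natC (primrec_two_pow hs))
        (primrec_minC
          (primrec_addC hr (primrec_negateC (Primrec.fst.comp (Primrec.unpair.comp hi))))
          (primrec_addC (Primrec.snd.comp (Primrec.unpair.comp hi)) (primrec_negateC hr)))))
  have hstep : Primrec₂ fun (x : (Code × ℕ) × ℕ) (y : ℕ × ℕ) =>
      bif (x.1.1.evaln x.1.2 y.1).isSome then maxC y.2 (trapezoidC y.1 x.1.2 x.2) else y.2 :=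
    Primrec.cond (Primrec.option_isSome.comp (Code.primrec_evaln.comp ((hs.pair he).pair hi)))
      (primrec_maxC hv ht) hv
  refine (Primrec.nat_rec' (Primrec.snd.comp Primrec.fst) (Primrec.const (natC 0)) hstep).of_eq
    fun x => ?_
  suffices H : ∀ m, (Nat.rec (natC 0) (fun i v => bif (x.1.1.evaln x.1.2 i).isSome then
      maxC v (trapezoidC i x.1.2 x.2) else v) m : ℕ) = stageFunC x.1.1 x.1.2 m x.2 from H _
  intro m
  induction m with
  | zero => rfl
  | succ m ih => simp only [stageFunC, ← ih]

theorem abs_trapezoid_sub_le (i s : ℕ) (x y : ℝ) :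
    |trapezoid i s x - trapezoid i s y| ≤ 2 ^ s * |x - y| := by
  unfold trapezoid
  refine (abs_min_sub_min_le_max _ _ _ _).trans (max_le (by simp) ?_)
  refine (abs_max_sub_max_le_max _ _ _ _).trans (max_le (by simp) ?_)
  rw [← mul_sub, abs_mul, abs_of_pos (show (0 : ℝ) < 2 ^ s by positivity)]
  refine mul_le_mul_of_nonneg_left ?_ (by positivity)
  refine (abs_min_sub_min_le_max _ _ _ _).trans (max_le ?_ ?_)
  · simp
  · rw [sub_sub_sub_cancel_left, abs_sub_comm]

theorem abs_stageFun_sub_le (e : Code) (s m : ℕ) (x y : ℝ) :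
    |stageFun e s m x - stageFun e s m y| ≤ 2 ^ s * |x - y| := by
  induction m with
  | zero => simp only [stageFun, sub_self, abs_zero]; positivity
  | succ m ih =>
    rw [stageFun, stageFun]
    cases (e.evaln s m).isSome
    · simpa using ih
    · exact (abs_max_sub_max_le_max _ _ _ _).trans (max_le ih (abs_trapezoid_sub_le _ _ _ _))

theorem uniformContinuous_stageFun (e : Code) (s m : ℕ) :
    UniformContinuous (stageFun e s m) :=
  (LipschitzWith.of_dist_le_mul (K := 2 ^ s) fun x y => by
    simpa [Real.dist_eq] using abs_stageFun_sub_le e s m x y).uniformContinuous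

theorem trapezoid_le_one (i s : ℕ) (x : ℝ) : trapezoid i s x ≤ 1 := min_le_left _ _

theorem trapezoid_eq_zero {i s : ℕ} {x : ℝ} (hx : x ∉ ratInterval i) : trapezoid i s x = 0 := by
  unfold trapezoid
  have h : min (x - ratOfNat i.unpair.1) (ratOfNat i.unpair.2 - x) ≤ 0 := by
    by_contra! h
    rw [lt_min_iff] at h
    exact hx ⟨by linarith [h.1], by linarith [h.2]⟩
  rw [max_eq_left (mul_nonpos_of_nonneg_of_nonpos (by positivity) h), min_eq_right zero_le_one]

theorem stageFun_nonneg (e : Code) (s m : ℕ) (x : ℝ) : 0 ≤ stageFun e s m x := by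
  induction m with
  | zero => exact le_rfl
  | succ m ih =>
    rw [stageFun]
    cases (e.evaln s m).isSome
    · exact ih
    · exact ih.trans (le_max_left _ _)

theorem stageFun_le_one (e : Code) (s m : ℕ) (x : ℝ) : stageFun e s m x ≤ 1 := by
  induction m with
  | zero => exact zero_le_one
  | succ m ih =>
    rw [stageFun]
    cases (e.evaln s m).isSome
    · exact ih
    · exact max_le ih (trapezoid_le_one _ _ _)

theorem stageFun_eq_zero {e : Code} {U : Set ℝ} (he : IsSigmaIndex e U) (s m : ℕ) {x : ℝ}
    (hx : x ∉ U) : stageFun e s m x = 0 := by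
  induction m with
  | zero => rfl
  | succ m ih =>
    rw [stageFun]
    cases h : (e.evaln s m).isSome
    · exact ih
    · obtain ⟨v, hv⟩ := Option.isSome_iff_exists.1 h
      have hm : ratInterval m ⊆ U :=
        (he.2 m).1 (Part.dom_iff_mem.2 ⟨v, Code.evaln_sound hv⟩)
      rw [cond_true, ih, trapezoid_eq_zero fun h => hx (hm h), max_self]

theorem trapezoid_le_stageFun {e : Code} {s i : ℕ} (h : (e.evaln s i).isSome = true) (x : ℝ)
    {m : ℕ} (hm : i < m) : trapezoid i s x ≤ stageFun e s m x := by
  induction m with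
  | zero => omega
  | succ m ih =>
    rw [stageFun]
    rcases Nat.lt_succ_iff_lt_or_eq.1 hm with h' | rfl
    · cases (e.evaln s m).isSome
      · exact ih h'
      · exact (ih h').trans (le_max_left _ _)
    · rw [h]
      exact le_max_right _ _

theorem exists_mem_ratInterval_subset {U : Set ℝ} (hU : IsOpen U) {x : ℝ} (hx : x ∈ U) :
    ∃ i, x ∈ ratInterval i ∧ ratInterval i ⊆ U := by
  obtain ⟨ε, hε, hεU⟩ := Metric.isOpen_iff.1 hU x hx
  obtain ⟨p, hp1, hp2⟩ := exists_rat_btwn (show x - ε < x by linarith)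
  obtain ⟨q, hq1, hq2⟩ := exists_rat_btwn (show x < x + ε by linarith)
  obtain ⟨a, rfl⟩ := ratOfNat_surjective p
  obtain ⟨b, rfl⟩ := ratOfNat_surjective q
  refine ⟨Nat.pair a b, by simpa [ratInterval] using ⟨hp2, hq1⟩, fun y hy => hεU ?_⟩
  simp only [ratInterval, Nat.unpair_pair, Set.mem_Ioo] at hy
  rw [Metric.mem_ball, Real.dist_eq, abs_lt]
  constructor <;> linarith [hy.1, hy.2]

theorem eventually_stageFun_eq_one {e : Code} {U : Set ℝ} (he : IsSigmaIndex e U) {x : ℝ}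
    (hx : x ∈ U) : ∀ᶠ s in atTop, stageFun e s s x = 1 := by
  obtain ⟨i, hxi, hiU⟩ := exists_mem_ratInterval_subset he.1 hx
  obtain ⟨s₀, hs₀⟩ := Code.evaln_complete.1 (Part.get_mem ((he.2 i).2 hiU))
  have hpos : 0 < min (x - ratOfNat i.unpair.1) (ratOfNat i.unpair.2 - x) :=
    lt_min (by linarith [hxi.1]) (by linarith [hxi.2])
  have hlim : ∀ᶠ s : ℕ in atTop, (min (x - ratOfNat i.unpair.1) (ratOfNat i.unpair.2 - x))⁻¹ ≤
      (2 : ℝ) ^ s :=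
    (tendsto_pow_atTop_atTop_of_one_lt (by norm_num)).eventually_ge_atTop _
  filter_upwards [hlim, eventually_ge_atTop s₀, eventually_gt_atTop i] with s h1 h2 h3
  refine le_antisymm (stageFun_le_one _ _ _ _) ?_
  have h4 : trapezoid i s x = 1 := by
    refine min_eq_left (le_max_of_le_right ?_)
    rwa [inv_le_iff_one_le_mul₀ hpos] at h1
  rw [← h4]
  exact trapezoid_le_stageFun
    (Option.isSome_iff_exists.2 ⟨_, Code.evaln_mono h2 hs₀⟩) x h3

section Integral

variable (μ : Measure ℝ) [IsFiniteMeasure μ] {e : Code} {U : Set ℝ}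

theorem integrable_stageFun (e : Code) (s m : ℕ) : Integrable (stageFun e s m) μ :=
  Integrable.of_bound (uniformContinuous_stageFun e s m).continuous.aestronglyMeasurable 1
    (Eventually.of_forall fun x => by
      rw [Real.norm_eq_abs, abs_of_nonneg (stageFun_nonneg _ _ _ _)]
      exact stageFun_le_one _ _ _ _)

theorem integral_stageFun_le (he : IsSigmaIndex e U) (s m : ℕ) :
    ∫ x, stageFun e s m x ∂μ ≤ μ.real U := by
  rw [← integral_indicator_one he.1.measurableSet]
  refine integral_mono (integrable_stageFun μ e s m)
    ((integrable_const 1).indicator he.1.measurableSet) fun x => ?_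
  by_cases hx : x ∈ U
  · simpa [hx] using stageFun_le_one e s m x
  · simp [hx, stageFun_eq_zero he s m hx]

theorem tendsto_integral_stageFun (he : IsSigmaIndex e U) :
    Tendsto (fun s => ∫ x, stageFun e s s x ∂μ) atTop (𝓝 (μ.real U)) := by
  rw [← integral_indicator_one he.1.measurableSet]
  refine tendsto_integral_of_dominated_convergence (fun _ => 1)
    (fun s => (integrable_stageFun μ e s s).aestronglyMeasurable) (integrable_const 1)
    (fun s => Eventually.of_forall fun x => ?_) (Eventually.of_forall fun x => ?_)
  · rw [Real.norm_eq_abs, abs_of_nonneg (stageFun_nonneg _ _ _ _)]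
    exact stageFun_le_one _ _ _ _
  · by_cases hx : x ∈ U
    · refine tendsto_const_nhds.congr' ?_
      filter_upwards [eventually_stageFun_eq_one he hx] with s hs
      simp [hx, hs]
    · simp [hx, stageFun_eq_zero he _ _ hx]

end Integral

/-- Integrals of uniformly continuous functions determine the measure of open sets from below. -/
theorem isComputableMeasure_of_integralComputableOnUnifCont (μ : Measure ℝ) [IsFiniteMeasure μ]
    (h : IntegralComputableOnUnifCont μ) : IsComputableMeasure μ := by
  obtain ⟨φ, hφ, hφμ⟩ := h
  constructor
  · obtain ⟨g, -, hg⟩ := exists_computable_functional (α := Unit) (V := fun _ _ => natC 1)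
      (m := fun _ => 0) (Computable.const _).to₂ (Computable.const _)
    have h1 : IsFunctionIndex (g ()) fun _ => 1 :=
      isFunctionIndex_of_lipschitz (V := fun _ => natC 1) (m := 0) (hg ()) (by simp)
        (by simp [ratOfNat_natC])
    obtain ⟨d, -, hd⟩ := hφμ _ _ h1 uniformContinuous_const (by simp)
    exact ⟨d, by simpa using hd⟩
  · obtain ⟨g, hg, hgs⟩ := exists_computable_functional
      (V := fun (a : Code × ℕ) r => stageFunC a.1 a.2 a.2 r) primrec_stageFunC.to_comp
      (m := fun a => a.2) Computable.snd
    have hfun : ∀ e s, IsFunctionIndex (g (e, s)) (stageFun e s s) := fun e s =>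
      isFunctionIndex_of_lipschitz (hgs (e, s)) (abs_stageFun_sub_le e s s)
        (ratOfNat_stageFunC e s s)
    -- `((e, n), (s, k, d, v))`: the program `d` for the integral of the stage `s` certifies, by its
    -- `k`-th approximation `v`, that this integral exceeds the `n`-th rational.
    have hR : REPred fun x : (Code × ℕ) × (ℕ × ℕ × Code × ℕ) =>
        x.2.2.2.1 ∈ φ (g (x.1.1, x.2.1)) ∧ x.2.2.2.2 ∈ x.2.2.2.1.eval x.2.2.1 ∧
        ltC (addC x.1.2 (mulC (natC 2) (halfPowC x.2.2.1))) x.2.2.2.2 = true := by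
      have hw : Primrec fun x : (Code × ℕ) × (ℕ × ℕ × Code × ℕ) => x.2 := Primrec.snd
      have hk : Primrec fun x : (Code × ℕ) × (ℕ × ℕ × Code × ℕ) => x.2.2.1 :=
        Primrec.fst.comp (Primrec.snd.comp hw)
      have hd : Primrec fun x : (Code × ℕ) × (ℕ × ℕ × Code × ℕ) => x.2.2.2.1 :=
        Primrec.fst.comp (Primrec.snd.comp (Primrec.snd.comp hw))
      have hv : Primrec fun x : (Code × ℕ) × (ℕ × ℕ × Code × ℕ) => x.2.2.2.2 :=
        Primrec.snd.comp (Primrec.snd.comp (Primrec.snd.comp hw))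
      have hes : Primrec fun x : (Code × ℕ) × (ℕ × ℕ × Code × ℕ) => (x.1.1, x.2.1) :=
        (Primrec.fst.comp Primrec.fst).pair (Primrec.fst.comp hw)
      refine rePred_and (rePred_mem (hφ.comp (hg.comp hes.to_comp)) hd.to_comp)
        (rePred_and (rePred_mem (Code.eval_part.comp hd.to_comp hk.to_comp) hv.to_comp)
          (rePred_of_computable (Primrec.to_comp ?_)))
      exact primrec_ltC (primrec_addC (Primrec.snd.comp Primrec.fst)
        (primrec_mulC (Primrec.const _) (primrec_halfPowC hk))) hv
    obtain ⟨ψ, hψ, hψR⟩ := exists_computable_code_dom (rePred_exists hR)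
    refine ⟨fun e => Part.some (ψ e), hψ.partrec, fun e U he => ⟨ψ e, Part.mem_some _, fun n => ?_⟩⟩
    rw [hψR]
    have hlt : ∀ k v : ℕ, ltC (addC n (mulC (natC 2) (halfPowC k))) v = true ↔
        (ratOfNat n : ℝ) + 2 * (1 / 2) ^ k < ratOfNat v := by
      intro k v
      rw [ltC_iff, ratOfNat_addC, ratOfNat_mulC, ratOfNat_natC, ratOfNat_halfPowC,
        ← Rat.cast_lt (K := ℝ)]
      push_cast
      rfl
    have hφs : ∀ s, ∃ d ∈ φ (g (e, s)), IsRealIndex d (∫ x, stageFun e s s x ∂μ) := fun s =>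
      hφμ _ _ (hfun e s) (uniformContinuous_stageFun e s s)
        fun x => ⟨stageFun_nonneg _ _ _ _, stageFun_le_one _ _ _ _⟩
    constructor
    · rintro ⟨⟨s, k, d, v⟩, hd, hv, hl⟩
      obtain ⟨d', hd', p, hp, hpx⟩ := hφs s
      obtain rfl : d = d' := Part.mem_unique hd hd'
      obtain rfl : v = p k := Part.mem_unique hv (hp k)
      have h1 := (hlt _ _).1 hl
      have h2 := (abs_le.1 (hpx.abs_sub_le k)).2
      have h3 := integral_stageFun_le μ he s s
      dsimp only at h1
      linarith
    · intro hn
      obtain ⟨s, hs⟩ := ((tendsto_integral_stageFun μ he).eventually_const_lt hn).exists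
      obtain ⟨d, hd, p, hp, hpx⟩ := hφs s
      obtain ⟨k, hk⟩ := exists_pow_lt_of_lt_one
        (show 0 < (∫ x, stageFun e s s x ∂μ - (ratOfNat n : ℝ)) / 4 by linarith)
        (show (1 / 2 : ℝ) < 1 by norm_num)
      refine ⟨(s, k, d, p k), hd, hp k, (hlt _ _).2 ?_⟩
      have h2 := (abs_le.1 (hpx.abs_sub_le k)).1
      dsimp only
      linarith

/-! ### Approximating integrals by sums over grid cells -/

section Grid

variable (μ : Measure ℝ) [IsFiniteMeasure μ]

theorem exists_nat_measureReal_compl_Icc_lt {ε : ℝ} (hε : 0 < ε) :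
    ∃ T : ℕ, μ.real (Set.Icc (-(T : ℝ)) T)ᶜ < ε := by
  have hanti : Antitone fun T : ℕ => (Set.Icc (-(T : ℝ)) T)ᶜ := by
    intro S T h
    have h' : (S : ℝ) ≤ T := by exact_mod_cast h
    exact Set.compl_subset_compl.2 (Set.Icc_subset_Icc (neg_le_neg h') h')
  have hempty : ⋂ T : ℕ, (Set.Icc (-(T : ℝ)) T)ᶜ = ∅ := by
    refine Set.eq_empty_of_forall_notMem fun x hx => ?_
    obtain ⟨T, hT⟩ := exists_nat_ge |x|
    exact Set.mem_iInter.1 hx T (abs_le.1 hT)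
  have h := tendsto_measure_iInter_atTop (μ := μ)
    (fun T : ℕ => (measurableSet_Icc (a := -(T : ℝ)) (b := T)).compl.nullMeasurableSet) hanti
    ⟨0, measure_ne_top _ _⟩
  rw [hempty, measure_empty] at h
  obtain ⟨T, hT⟩ := (h.eventually_lt_const (ENNReal.ofReal_pos.2 hε)).exists
  exact ⟨T, (ENNReal.toReal_lt_of_lt_ofReal hT)⟩

/-- Among infinitely many pairwise disjoint shifts of a grid, one has small measure. -/
theorem exists_shift_measureReal_range_lt {h : ℝ} (hh : 0 < h) (T : ℝ) {ε : ℝ} (hε : 0 < ε) :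
    ∃ k : ℕ, μ.real (Set.range fun j : ℤ => T - h / (k + 2) + j * h) < ε := by
  have hfin := Measure.finite_const_le_meas_of_disjoint_iUnion μ (ENNReal.ofReal_pos.2 hε)
    (As := fun k : ℕ => Set.range fun j : ℤ => T - h / (k + 2) + j * h)
    (fun k => (Set.countable_range _).measurableSet) ?_ (measure_ne_top _ _)
  · obtain ⟨k, hk⟩ := hfin.exists_notMem
    exact ⟨k, ENNReal.toReal_lt_of_lt_ofReal (not_le.1 hk)⟩
  · intro k l hkl
    rw [Function.onFun, Set.disjoint_left]
    rintro _ ⟨i, rfl⟩ ⟨j, hj⟩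
    have hk1 : (0 : ℝ) < 1 / (k + 2) := by positivity
    have hl1 : (0 : ℝ) < 1 / (l + 2) := by positivity
    have hk2 : (1 : ℝ) / (k + 2) < 1 := by
      rw [div_lt_one (by positivity)]
      linarith [k.cast_nonneg (α := ℝ)]
    have hl2 : (1 : ℝ) / (l + 2) < 1 := by
      rw [div_lt_one (by positivity)]
      linarith [l.cast_nonneg (α := ℝ)]
    have heq : ((j - i : ℤ) : ℝ) = 1 / (l + 2) - 1 / (k + 2) := by
      have : (j : ℝ) * h - i * h = h * (1 / (l + 2)) - h * (1 / (k + 2)) := by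
        simp only [mul_one_div]
        linarith
      push_cast
      refine mul_left_cancel₀ hh.ne' ?_
      linarith
    -- An integer strictly between `-1` and `1` vanishes.
    have h0 : j - i = 0 := by
      have h1 : ((j - i : ℤ) : ℝ) < (1 : ℤ) := by rw [heq]; push_cast; linarith
      have h2 : ((-1 : ℤ) : ℝ) < (j - i : ℤ) := by rw [heq]; push_cast; linarith
      have h1 := Int.cast_lt.1 h1
      have h2 := Int.cast_lt.1 h2
      omega
    rw [h0, Int.cast_zero] at heq
    have h3 : (1 : ℝ) / (l + 2) = 1 / (k + 2) := by linarith
    rw [one_div, one_div, inv_inj] at h3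
    exact hkl (by exact_mod_cast (by linarith : (k : ℝ) = l))

/-- Every open cover of the line is refined, up to a set of small measure, by finitely many cells
of a grid with rational step and rational origin. -/
theorem exists_grid {ι : Type*} {c : ι → Set ℝ} (hc : ∀ i, IsOpen (c i))
    (hcov : ∀ x, ∃ i, x ∈ c i) {ε : ℝ} (hε : 0 < ε) :
    ∃ (b h : ℚ) (n : ℕ), 0 < h ∧
      (∀ j < n, ∃ i, Set.Ioo ((b : ℝ) + j * h) (b + (j + 1) * h) ⊆ c i) ∧
      μ.real Set.univ - ε <
        ∑ j ∈ Finset.range n, μ.real (Set.Ioo ((b : ℝ) + j * h) (b + (j + 1) * h)) := by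
  obtain ⟨T, hT⟩ := exists_nat_measureReal_compl_Icc_lt μ (half_pos hε)
  obtain ⟨δ, hδ, hδc⟩ := lebesgue_number_lemma_of_metric
    (isCompact_Icc (a := -(T : ℝ) - 1) (b := T)) hc
    fun x _ => Set.mem_iUnion.2 (hcov x)
  obtain ⟨H, hH⟩ := exists_nat_one_div_lt hδ
  have hHpos : (0 : ℝ) < 1 / ((H : ℝ) + 1) := by positivity
  have hH1 : 1 / ((H : ℝ) + 1) ≤ 1 := by
    rw [div_le_one (by positivity)]
    linarith [H.cast_nonneg (α := ℝ)]
  obtain ⟨k, hk⟩ := exists_shift_measureReal_range_lt μ hHpos (-(T : ℝ)) (half_pos hε)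
  set G := Set.range fun j : ℤ => -(T : ℝ) - 1 / ((H : ℝ) + 1) / (k + 2) + j * (1 / ((H : ℝ) + 1))
    with hG
  let h : ℚ := 1 / ((H : ℚ) + 1)
  let b : ℚ := -(T : ℚ) - h / (k + 2)
  have hh : (h : ℝ) = 1 / ((H : ℝ) + 1) := by simp [h]
  have hb : (b : ℝ) = -(T : ℝ) - h / (k + 2) := by simp [b]
  rw [← hh] at hHpos hH1 hH hG
  rw [← hb] at hG
  have hk0 : 0 < (h : ℝ) / (k + 2) := by positivity
  have hk1 : (h : ℝ) / (k + 2) < h := by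
    rw [div_lt_iff₀ (by positivity)]
    nlinarith [k.cast_nonneg (α := ℝ)]
  have hTh : (h : ℝ) * (2 * T * (H + 1)) = 2 * T := by
    rw [hh]
    field_simp
  refine ⟨b, h, 2 * T * (H + 1) + 1, by positivity, fun j hj => ?_, ?_⟩
  · have hj' : (j : ℝ) ≤ 2 * T * (H + 1) := by exact_mod_cast Nat.lt_succ_iff.1 hj
    have hjh : (j : ℝ) * h ≤ 2 * T := by
      rw [← hTh, mul_comm]
      exact mul_le_mul_of_nonneg_left hj' hHpos.le
    have hj0 : 0 ≤ (j : ℝ) * h := by positivity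
    obtain ⟨i, hi⟩ := hδc ((b : ℝ) + j * h) ⟨by linarith, by linarith⟩
    refine ⟨i, fun y hy => hi ?_⟩
    rw [Metric.mem_ball, Real.dist_eq, abs_lt]
    constructor <;> linarith [hy.1, hy.2]
  · set n := 2 * T * (H + 1) + 1 with hn
    have hcover : (Set.univ : Set ℝ) ⊆ ((Set.Icc (-(T : ℝ)) T)ᶜ ∪ G) ∪
        ⋃ j ∈ Finset.range n, Set.Ioo ((b : ℝ) + j * h) (b + (j + 1) * h) := by
      intro x _
      by_cases hx : x ∈ Set.Icc (-(T : ℝ)) T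
      · set j := ⌊(x - b) / h⌋ with hj
        have h1 : (j : ℝ) * h ≤ x - b := (le_div_iff₀ hHpos).1 (Int.floor_le _)
        have h2 : x - b < (j + 1) * h := (div_lt_iff₀ hHpos).1 (Int.lt_floor_add_one _)
        rcases h1.eq_or_lt with h3 | h3
        · exact Or.inl (Or.inr (hG ▸ ⟨j, by dsimp only; linarith⟩))
        · have hj0 : 0 ≤ j := by
            rw [hj]
            refine Int.floor_nonneg.2 (div_nonneg ?_ hHpos.le)
            linarith [hx.1]
          have hjn : j < (n : ℤ) := by
            have h4 : (j : ℝ) * h < (n : ℝ) * h := by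
              rw [hn]
              push_cast
              linarith [hx.2]
            exact_mod_cast lt_of_mul_lt_mul_right h4 hHpos.le
          obtain ⟨i, hi⟩ := Int.eq_ofNat_of_zero_le hj0
          rw [hi] at h2 h3 hjn
          refine Or.inr (Set.mem_biUnion (Finset.mem_coe.2 (Finset.mem_range.2
            (by exact_mod_cast hjn : i < n))) ⟨?_, ?_⟩)
          · push_cast at h3
            linarith
          · push_cast at h2
            linarith
      · exact Or.inl (Or.inl hx)
    have h1 := measureReal_mono (μ := μ) hcover
    have h2 := measureReal_union_le (μ := μ) ((Set.Icc (-(T : ℝ)) T)ᶜ ∪ G)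
      (⋃ j ∈ Finset.range n, Set.Ioo ((b : ℝ) + j * h) (b + (j + 1) * h))
    have h3 := measureReal_union_le (μ := μ) (Set.Icc (-(T : ℝ)) T)ᶜ G
    have h4 := measureReal_biUnion_finset_le (μ := μ) (Finset.range n)
      fun j : ℕ => Set.Ioo ((b : ℝ) + j * h) (b + (j + 1) * h)
    linarith

/-- If `f` is within `η` of `v j` on the disjoint sets `I j` and `m j ≤ μ (I j)`, then
`∑ v j * m j` approximates `∫ f`, with an error governed by the mass `μ(ℝ) - ∑ m j` that the lower
bounds `m j` miss. -/
theorem abs_sum_sub_integral_le {f : ℝ → ℝ} (hf : Integrable f μ) {B : ℝ}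
    (hf0 : ∀ x, 0 ≤ f x) (hfB : ∀ x, f x ≤ B) {I : ℕ → Set ℝ} {n : ℕ}
    (hI : ∀ j, MeasurableSet (I j)) (hne : ∀ j < n, (I j).Nonempty)
    (hdisj : Pairwise (Function.onFun Disjoint I)) {v m : ℕ → ℝ} {η : ℝ}
    (hv : ∀ j < n, ∀ x ∈ I j, |v j - f x| ≤ η) (hm : ∀ j < n, m j ≤ μ.real (I j)) (hη : 0 ≤ η) :
    |∑ j ∈ Finset.range n, v j * m j - ∫ x, f x ∂μ| ≤
      η * μ.real Set.univ + (B + η) * (μ.real Set.univ - ∑ j ∈ Finset.range n, m j) := by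
  set S := ⋃ j ∈ Finset.range n, I j with hS
  have hSm : MeasurableSet S := Finset.measurableSet_biUnion _ fun j _ => hI j
  have hsum : μ.real S = ∑ j ∈ Finset.range n, μ.real (I j) :=
    measureReal_biUnion_finset (fun i _ j _ hij => hdisj hij) fun j _ => hI j
  have hcompl : μ.real Sᶜ = μ.real Set.univ - μ.real S := measureReal_compl hSm
  have hint : ∫ x, f x ∂μ = ∑ j ∈ Finset.range n, ∫ x in I j, f x ∂μ + ∫ x in Sᶜ, f x ∂μ := by
    rw [← integral_add_compl hSm hf, hS, integral_biUnion_finset _ (fun j _ => hI j)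
      (fun i _ j _ hij => hdisj hij) fun j _ => hf.integrableOn]
  have hc0 : 0 ≤ ∫ x in Sᶜ, f x ∂μ := setIntegral_nonneg hSm.compl fun x _ => hf0 x
  have hcB : ∫ x in Sᶜ, f x ∂μ ≤ B * μ.real Sᶜ := by
    refine (integral_mono hf.integrableOn (integrable_const B) hfB).trans_eq ?_
    rw [setIntegral_const, smul_eq_mul, mul_comm]
  have hcell : ∀ j ∈ Finset.range n, |v j * m j - ∫ x in I j, f x ∂μ| ≤
      η * μ.real (I j) + (B + η) * (μ.real (I j) - m j) := by
    intro j hj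
    have hj := Finset.mem_range.1 hj
    obtain ⟨y, hy⟩ := hne j hj
    have h1 := abs_le.1 (hv j hj y hy)
    have hvabs : |v j| ≤ B + η :=
      abs_le.2 ⟨by linarith [h1.1, hf0 y, (hf0 y).trans (hfB y)], by linarith [h1.2, hfB y]⟩
    have h2 : |v j * μ.real (I j) - ∫ x in I j, f x ∂μ| ≤ η * μ.real (I j) := by
      have h3 : v j * μ.real (I j) - ∫ x in I j, f x ∂μ = ∫ x in I j, (v j - f x) ∂μ := by
        rw [integral_sub (integrable_const _) hf.integrableOn, setIntegral_const, smul_eq_mul,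
          mul_comm]
      rw [h3, ← Real.norm_eq_abs]
      exact norm_setIntegral_le_of_norm_le_const (measure_lt_top _ _) fun x hx => hv j hj x hx
    have h4 : |v j * (μ.real (I j) - m j)| ≤ (B + η) * (μ.real (I j) - m j) := by
      rw [abs_mul, abs_of_nonneg (sub_nonneg.2 (hm j hj))]
      exact mul_le_mul_of_nonneg_right hvabs (sub_nonneg.2 (hm j hj))
    rw [abs_le] at h2 h4 ⊢
    constructor <;> linarith [h2.1, h2.2, h4.1, h4.2]
  have htot := (Finset.abs_sum_le_sum_abs _ _).trans (Finset.sum_le_sum hcell)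
  rw [Finset.sum_sub_distrib, Finset.sum_add_distrib, ← Finset.mul_sum, ← Finset.mul_sum,
    Finset.sum_sub_distrib, ← hsum] at htot
  have hS0 : 0 ≤ μ.real Sᶜ := measureReal_nonneg
  have hB : 0 ≤ B := (hf0 0).trans (hfB 0)
  have h5 : 0 ≤ B * μ.real Sᶜ := mul_nonneg hB hS0
  have h6 : 0 ≤ η * μ.real Sᶜ := mul_nonneg hη hS0
  rw [hint]
  rw [hcompl] at hcB h5 h6
  rw [abs_le] at htot ⊢
  constructor <;> nlinarith [htot.1, htot.2, mul_nonneg hη (hcompl ▸ hS0)]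

end Grid

/-! ### Computing integrals from the measure -/

section Predicates

variable {α : Type*} [Primcodable α]

theorem rePred_ratOfNat_lt {f g : α → ℕ} (hf : Computable f) (hg : Computable g) :
    REPred fun a => ratOfNat (f a) < ratOfNat (g a) := by
  have h : Primrec₂ ltC := primrec_ltC Primrec.fst Primrec.snd
  exact (rePred_of_computable (h.to_comp.comp hf hg)).of_eq fun a => ltC_iff _ _

theorem rePred_ratOfNat_le {f g : α → ℕ} (hf : Computable f) (hg : Computable g) :
    REPred fun a => ratOfNat (f a) ≤ ratOfNat (g a) := by
  have h : Primrec₂ ltC := primrec_ltC Primrec.fst Primrec.snd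
  refine (rePred_of_computable (Primrec.not.to_comp.comp (h.to_comp.comp hg hf))).of_eq fun a => ?_
  rw [Bool.not_eq_true', ← Bool.not_eq_true, ltC_iff, not_lt]

theorem rePred_isNamePrefix {ρ : α → ℕ → ℕ} (hρ : Primrec₂ ρ) {k : α → ℕ} (hk : Computable k) :
    REPred fun a => IsNamePrefix (ρ a) (k a) := by
  have hi : Primrec fun x : α × ℕ => ρ x.1 x.2 := hρ
  have hi' : Primrec fun x : α × ℕ => ρ x.1 (x.2 + 1) :=
    hρ.comp Primrec.fst (Primrec.succ.comp Primrec.snd)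
  have hp : Primrec fun x : α × ℕ => halfPowC x.2 := primrec_halfPowC Primrec.snd
  have h : REPred fun x : α × ℕ =>
      |ratOfNat (ρ x.1 x.2) - ratOfNat (ρ x.1 (x.2 + 1))| < (1 / 2 : ℚ) ^ x.2 := by
    refine (rePred_and
      (rePred_ratOfNat_lt hi.to_comp (primrec_addC hi' hp).to_comp)
      (rePred_ratOfNat_lt hi'.to_comp (primrec_addC hi hp).to_comp)).of_eq fun x => ?_
    rw [ratOfNat_addC, ratOfNat_addC, ratOfNat_halfPowC, abs_sub_lt_iff, sub_lt_iff_lt_add',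
      sub_lt_iff_lt_add']
  exact rePred_forall_lt h hk

theorem rePred_haltsWith {e : α → Code} (he : Primrec e) {ρ : α → ℕ → ℕ} (hρ : Primrec₂ ρ)
    {n k v : α → ℕ} (hn : Primrec n) (hk : Primrec k) (hv : Primrec v) :
    REPred fun a => HaltsWith (e a) (ρ a) (n a) (k a) (v a) := by
  have hstep : Partrec fun x : α × ℕ => oracleStep (e x.1) (ρ x.1) (n x.1) x.2 := by
    have hlist : Primrec fun x : α × ℕ => (List.range x.2).map (ρ x.1) :=
      Primrec.list_map (Primrec.list_range.comp Primrec.snd)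
        (hρ.comp (Primrec.fst.comp Primrec.fst) Primrec.snd)
    exact Code.eval_part.comp (he.comp Primrec.fst).to_comp
      (Primrec₂.natPair.comp (Primrec.encode.comp hlist) (hn.comp Primrec.fst)).to_comp
  exact rePred_and (rePred_forall_lt (rePred_mem hstep (Computable.const 0)) hk.to_comp)
    (rePred_mem (hstep.comp (Computable.id.pair hk.to_comp)) (Primrec.succ.comp hv).to_comp)

end Predicates

/-- Containment between rational intervals is decidable, so these have computable indices. -/
theorem exists_computable_isSigmaIndex :
    ∃ g : ℕ → Code, Computable g ∧ ∀ i, IsSigmaIndex (g i) (ratInterval i) := by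
  have hR : REPred fun x : ℕ × ℕ => (!ltC x.2.unpair.1 x.2.unpair.2 ||
      (!ltC x.2.unpair.1 x.1.unpair.1 && !ltC x.1.unpair.2 x.2.unpair.2)) = true := by
    have ha : Primrec fun x : ℕ × ℕ => x.1.unpair.1 :=
      Primrec.fst.comp (Primrec.unpair.comp Primrec.fst)
    have hb : Primrec fun x : ℕ × ℕ => x.1.unpair.2 :=
      Primrec.snd.comp (Primrec.unpair.comp Primrec.fst)
    have hc : Primrec fun x : ℕ × ℕ => x.2.unpair.1 :=
      Primrec.fst.comp (Primrec.unpair.comp Primrec.snd)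
    have hd : Primrec fun x : ℕ × ℕ => x.2.unpair.2 :=
      Primrec.snd.comp (Primrec.unpair.comp Primrec.snd)
    exact rePred_of_computable (Primrec.or.comp (Primrec.not.comp (primrec_ltC hc hd))
      (Primrec.and.comp (Primrec.not.comp (primrec_ltC hc ha))
        (Primrec.not.comp (primrec_ltC hb hd)))).to_comp
  obtain ⟨g, hg, hgR⟩ := exists_computable_code_dom hR
  refine ⟨g, hg, fun i => ⟨isOpen_Ioo, fun j => ?_⟩⟩
  rw [hgR]
  have hlt : ∀ x y, (!ltC x y) = true ↔ (ratOfNat y : ℝ) ≤ ratOfNat x := fun x y => by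
    rw [Bool.not_eq_true', ← Bool.not_eq_true, ltC_iff, not_lt, Rat.cast_le]
  rw [Bool.or_eq_true, Bool.and_eq_true, hlt, hlt, hlt]
  unfold ratInterval
  rcases le_or_gt (ratOfNat j.unpair.2 : ℝ) (ratOfNat j.unpair.1) with h | h
  · exact iff_of_true (Or.inl h) (by rw [Set.Ioo_eq_empty (not_lt.2 h)]; exact Set.empty_subset _)
  · rw [Set.Ioo_subset_Ioo_iff h, or_iff_right (not_le.2 h)]

/-- The data `(σ, k, v, m)` certify for the cell between the rationals coded by `a` and `c`: the
functional `e`, reading the first `k` symbols of the name prefix `σ`, outputs `v` at precision `n`;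
the cell lies in the ball around the `k`-th rational of `σ` on which this output is valid; and the
program that `φ` assigns to the cell confirms that `m` codes a lower bound of its measure. -/
def IsCellCert (φ : Code →. Code) (idx : ℕ → Code) (e : Code) (n a c : ℕ)
    (t : List ℕ × ℕ × ℕ × ℕ) : Prop :=
  IsNamePrefix (fun i => t.1.getD i 0) t.2.1 ∧
    HaltsWith e (fun i => t.1.getD i 0) n t.2.1 t.2.2.1 ∧
    ratOfNat (t.1.getD t.2.1 0) - (1 / 2 : ℚ) ^ t.2.1 ≤ ratOfNat a ∧
    ratOfNat c ≤ ratOfNat (t.1.getD t.2.1 0) + (1 / 2 : ℚ) ^ t.2.1 ∧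
    ∃ d, d ∈ φ (idx (Nat.pair a c)) ∧ (d.eval t.2.2.2).Dom

theorem rePred_isCellCert {φ : Code →. Code} (hφ : Partrec φ) {idx : ℕ → Code}
    (hidx : Computable idx) {α : Type*} [Primcodable α] {e : α → Code} {n a c : α → ℕ}
    {t : α → List ℕ × ℕ × ℕ × ℕ} (he : Primrec e) (hn : Primrec n) (ha : Primrec a)
    (hc : Primrec c) (ht : Primrec t) :
    REPred fun x => IsCellCert φ idx (e x) (n x) (a x) (c x) (t x) := by
  have hk : Primrec fun x => (t x).2.1 := Primrec.fst.comp (Primrec.snd.comp ht)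
  have hv : Primrec fun x => (t x).2.2.1 :=
    Primrec.fst.comp (Primrec.snd.comp (Primrec.snd.comp ht))
  have hm : Primrec fun x => (t x).2.2.2 :=
    Primrec.snd.comp (Primrec.snd.comp (Primrec.snd.comp ht))
  have hσ : Primrec₂ fun x i => (t x).1.getD i 0 :=
    (Primrec.list_getD 0).comp (Primrec.fst.comp (ht.comp Primrec.fst)) Primrec.snd
  have hq : Primrec fun x => (t x).1.getD (t x).2.1 0 := hσ.comp Primrec.id hk
  have hp : Primrec fun x => halfPowC (t x).2.1 := primrec_halfPowC hk
  refine rePred_and (rePred_isNamePrefix hσ hk.to_comp)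
    (rePred_and (rePred_haltsWith he hσ hn hk hv) (rePred_and ?_ (rePred_and ?_ ?_)))
  · refine (rePred_ratOfNat_le (primrec_addC hq (primrec_negateC hp)).to_comp ha.to_comp).of_eq
      fun x => ?_
    rw [ratOfNat_addC, ratOfNat_negateC, ratOfNat_halfPowC, sub_eq_add_neg]
  · refine (rePred_ratOfNat_le hc.to_comp (primrec_addC hq hp).to_comp).of_eq fun x => ?_
    rw [ratOfNat_addC, ratOfNat_halfPowC]
  · refine rePred_exists (p := fun y => y.2 ∈ φ (idx (Nat.pair (a y.1) (c y.1))) ∧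
      (y.2.eval (t y.1).2.2.2).Dom) (rePred_and (rePred_mem ?_ Computable.snd) (rePred_dom ?_))
    · exact hφ.comp (hidx.comp (Primrec₂.natPair.comp ha hc).to_comp |>.comp Computable.fst)
    · exact Code.eval_part.comp Computable.snd (hm.to_comp.comp Computable.fst)

/-- The code of `b + j * h`. -/
def gridC (b h j : ℕ) : ℕ := addC b (mulC (natC j) h)

theorem ratOfNat_gridC (b h j : ℕ) :
    ratOfNat (gridC b h j) = ratOfNat b + j * ratOfNat h := by
  rw [gridC, ratOfNat_addC, ratOfNat_mulC, ratOfNat_natC]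

/-- A witness for an approximation of an integral at precision `n`: a grid with origin `b`, step
`h` and `l` cells together with a list of certificates for the cells. The certified lower bounds
of the measures of the cells have a sum above `q`. -/
def IsGridCert (φ : Code →. Code) (idx : ℕ → Code) (e : Code) (n q : ℕ)
    (w : ℕ × ℕ × ℕ × List (List ℕ × ℕ × ℕ × ℕ)) : Prop :=
  ratOfNat (natC 0) < ratOfNat w.2.1 ∧
    ratOfNat q < ratOfNat (sumC (fun j => (w.2.2.2.getD j ([], 0, 0, 0)).2.2.2) w.2.2.1) ∧
    ∀ j < w.2.2.1, IsCellCert φ idx e n (gridC w.1 w.2.1 j) (gridC w.1 w.2.1 (j + 1))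
      (w.2.2.2.getD j ([], 0, 0, 0))

theorem rePred_isGridCert {φ : Code →. Code} (hφ : Partrec φ) {idx : ℕ → Code}
    (hidx : Computable idx) {α : Type*} [Primcodable α] {e : α → Code} {n q : α → ℕ}
    {w : α → ℕ × ℕ × ℕ × List (List ℕ × ℕ × ℕ × ℕ)} (he : Primrec e) (hn : Primrec n)
    (hq : Computable q) (hw : Primrec w) :
    REPred fun x => IsGridCert φ idx (e x) (n x) (q x) (w x) := by
  have hb : Primrec fun x => (w x).1 := Primrec.fst.comp hw
  have hh : Primrec fun x => (w x).2.1 := Primrec.fst.comp (Primrec.snd.comp hw)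
  have hl : Primrec fun x => (w x).2.2.1 :=
    Primrec.fst.comp (Primrec.snd.comp (Primrec.snd.comp hw))
  have hD : Primrec fun x => (w x).2.2.2 :=
    Primrec.snd.comp (Primrec.snd.comp (Primrec.snd.comp hw))
  have ht : Primrec fun y : α × ℕ => (w y.1).2.2.2.getD y.2 ([], 0, 0, 0) :=
    (Primrec.list_getD _).comp (hD.comp Primrec.fst) Primrec.snd
  have hm : Primrec₂ fun (x : α) (j : ℕ) => ((w x).2.2.2.getD j ([], 0, 0, 0)).2.2.2 :=
    Primrec.snd.comp (Primrec.snd.comp (Primrec.snd.comp ht))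
  have hgrid : ∀ {j : α × ℕ → ℕ}, Primrec j →
      Primrec fun y : α × ℕ => gridC (w y.1).1 (w y.1).2.1 (j y) := fun hj =>
    primrec_addC (hb.comp Primrec.fst) (primrec_mulC (primrec_natC hj) (hh.comp Primrec.fst))
  exact rePred_and (rePred_ratOfNat_lt (Computable.const _) hh.to_comp)
    (rePred_and (rePred_ratOfNat_lt hq (primrec_sumC hm hl).to_comp)
      (rePred_forall_lt (rePred_isCellCert hφ hidx (he.comp Primrec.fst) (hn.comp Primrec.fst)
        (hgrid Primrec.snd) (hgrid (Primrec.succ.comp Primrec.snd)) ht) hl.to_comp))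

/-- The approximation of an integral encoded in a grid certificate. -/
def gridValueC (w : ℕ × ℕ × ℕ × List (List ℕ × ℕ × ℕ × ℕ)) : ℕ :=
  sumC (fun j => mulC (w.2.2.2.getD j ([], 0, 0, 0)).2.2.1 (w.2.2.2.getD j ([], 0, 0, 0)).2.2.2)
    w.2.2.1

theorem primrec_gridValueC {α : Type*} [Primcodable α]
    {w : α → ℕ × ℕ × ℕ × List (List ℕ × ℕ × ℕ × ℕ)} (hw : Primrec w) :
    Primrec fun x => gridValueC (w x) := by
  have hl : Primrec fun x => (w x).2.2.1 :=
    Primrec.fst.comp (Primrec.snd.comp (Primrec.snd.comp hw))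
  have hD : Primrec fun x => (w x).2.2.2 :=
    Primrec.snd.comp (Primrec.snd.comp (Primrec.snd.comp hw))
  have ht : Primrec fun y : α × ℕ => (w y.1).2.2.2.getD y.2 ([], 0, 0, 0) :=
    (Primrec.list_getD _).comp (hD.comp Primrec.fst) Primrec.snd
  have hvm : Primrec₂ fun (x : α) (j : ℕ) =>
      mulC ((w x).2.2.2.getD j ([], 0, 0, 0)).2.2.1 ((w x).2.2.2.getD j ([], 0, 0, 0)).2.2.2 :=
    primrec_mulC (Primrec.fst.comp (Primrec.snd.comp (Primrec.snd.comp ht)))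
      (Primrec.snd.comp (Primrec.snd.comp (Primrec.snd.comp ht)))
  exact primrec_sumC hvm hl

section Correctness

variable {μ : Measure ℝ} {φ : Code →. Code} {idx : ℕ → Code}

theorem exists_dom_eval_iff
    (hφ : ∀ (e : Code) (U : Set ℝ), IsSigmaIndex e U → ∃ d ∈ φ e, IsLeftCutIndex d (μ.real U))
    (hidx : ∀ i, IsSigmaIndex (idx i) (ratInterval i))
    (a c m : ℕ) :
    (∃ d, d ∈ φ (idx (Nat.pair a c)) ∧ (d.eval m).Dom) ↔
      (ratOfNat m : ℝ) < μ.real (Set.Ioo (ratOfNat a : ℝ) (ratOfNat c)) := by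
  obtain ⟨d, hd, hdm⟩ := hφ _ _ (hidx (Nat.pair a c))
  have hI : ratInterval (Nat.pair a c) = Set.Ioo (ratOfNat a : ℝ) (ratOfNat c) := by
    simp [ratInterval]
  rw [hI] at hdm
  rw [← hdm]
  constructor
  · rintro ⟨d', hd', h⟩
    rwa [Part.mem_unique hd hd']
  · exact fun h => ⟨d, hd, h⟩

theorem IsGridCert.abs_sub_integral_le [IsFiniteMeasure μ]
    (hφ : ∀ (e : Code) (U : Set ℝ), IsSigmaIndex e U → ∃ d ∈ φ e, IsLeftCutIndex d (μ.real U))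
    (hidx : ∀ i, IsSigmaIndex (idx i) (ratInterval i)) {e : Code} {f : ℝ → ℝ}
    (he : IsFunctionIndex e f) {n q : ℕ} {w : ℕ × ℕ × ℕ × List (List ℕ × ℕ × ℕ × ℕ)}
    (hw : IsGridCert φ idx e n q w) {B : ℝ} (hf0 : ∀ x, 0 ≤ f x) (hfB : ∀ x, f x ≤ B) :
    |(ratOfNat (gridValueC w) : ℝ) - ∫ x, f x ∂μ| ≤ 2 * (1 / 2) ^ n * μ.real Set.univ +
      (B + 2 * (1 / 2) ^ n) * (μ.real Set.univ - ratOfNat q) := by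
  obtain ⟨b, h, l, D⟩ := w
  obtain ⟨hh, hq, hcell⟩ := hw
  set t := fun j => D.getD j ([], 0, 0, 0) with ht
  dsimp only at hh hq hcell
  rw [ratOfNat_natC, Nat.cast_zero, ← Rat.cast_pos (K := ℝ)] at hh
  have hfint : Integrable f μ :=
    Integrable.of_bound he.continuous.aestronglyMeasurable B (Eventually.of_forall fun x => by
      rw [Real.norm_eq_abs, abs_of_nonneg (hf0 x)]
      exact hfB x)
  have hgrid : ∀ j : ℕ, (ratOfNat (gridC b h j) : ℝ) = ratOfNat b + j * ratOfNat h := fun j => by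
    rw [ratOfNat_gridC]
    push_cast
    rfl
  have hdisj : Pairwise (Function.onFun Disjoint fun j : ℕ =>
      Set.Ioo (ratOfNat (gridC b h j) : ℝ) (ratOfNat (gridC b h (j + 1)))) := by
    have hmono : Monotone fun j : ℕ => (ratOfNat (gridC b h j) : ℝ) := by
      intro i j hij
      have : (i : ℝ) ≤ j := by exact_mod_cast hij
      simp only [hgrid]
      gcongr
    simpa using hmono.pairwise_disjoint_on_Ioo_succ
  have hB : 0 ≤ B := (hf0 0).trans (hfB 0)
  have key := abs_sum_sub_integral_le μ hfint hf0 hfB (n := l)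
    (I := fun j : ℕ => Set.Ioo (ratOfNat (gridC b h j) : ℝ) (ratOfNat (gridC b h (j + 1))))
    (fun j => measurableSet_Ioo)
    (fun j _ => Set.nonempty_Ioo.2 (by rw [hgrid, hgrid]; push_cast; linarith)) hdisj
    (v := fun j => ratOfNat (t j).2.2.1) (m := fun j => ratOfNat (t j).2.2.2)
    (η := 2 * (1 / 2) ^ n) ?_ ?_ (by positivity)
  · have hv : (ratOfNat (gridValueC (b, h, l, D)) : ℝ) =
        ∑ j ∈ Finset.range l, (ratOfNat (t j).2.2.1 : ℝ) * ratOfNat (t j).2.2.2 := by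
      rw [gridValueC, ratOfNat_sumC]
      push_cast [ratOfNat_mulC]
      rfl
    have hq' : (ratOfNat q : ℝ) < ∑ j ∈ Finset.range l, (ratOfNat (t j).2.2.2 : ℝ) := by
      rw [ratOfNat_sumC] at hq
      exact_mod_cast hq
    rw [hv]
    refine key.trans ?_
    gcongr
  · intro j hj x hx
    obtain ⟨h1, h2, h3, h4, -⟩ := hcell j hj
    refine he.abs_sub_le_of_haltsWith h1 h2 ?_
    rw [← Rat.cast_le (K := ℝ)] at h3 h4
    push_cast at h3 h4
    rw [abs_lt]
    constructor <;> linarith [hx.1, hx.2]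
  · intro j hj
    exact ((exists_dom_eval_iff hφ hidx _ _ _).1 (hcell j hj).2.2.2.2).le

theorem exists_isGridCert [IsFiniteMeasure μ]
    (hφ : ∀ (e : Code) (U : Set ℝ), IsSigmaIndex e U → ∃ d ∈ φ e, IsLeftCutIndex d (μ.real U))
    (hidx : ∀ i, IsSigmaIndex (idx i) (ratInterval i)) {e : Code} {f : ℝ → ℝ}
    (he : IsFunctionIndex e f) (n : ℕ) {q : ℕ} (hq : (ratOfNat q : ℝ) < μ.real Set.univ) :
    ∃ w, IsGridCert φ idx e n q w := by
  set ε := (μ.real Set.univ - ratOfNat q) / 2 with hε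
  have hε0 : 0 < ε := by linarith
  -- The balls on which some halting computation determines `f`.
  obtain ⟨b', h', l, hh', hcell, hsum⟩ := exists_grid μ
    (ι := {y : (ℕ → ℕ) × ℕ × ℕ // IsNamePrefix y.1 y.2.1 ∧ HaltsWith e y.1 n y.2.1 y.2.2})
    (c := fun y => {x | |(ratOfNat (y.1.1 y.1.2.1) : ℝ) - x| < (1 / 2) ^ y.1.2.1})
    (fun y => isOpen_lt (by fun_prop) continuous_const)
    (fun x => by
      obtain ⟨ρ, k, v, hρ, hv, hx⟩ := he.exists_haltsWith x n
      exact ⟨⟨(ρ, k, v), hρ, hv⟩, hx⟩) hε0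
  obtain ⟨b, rfl⟩ := ratOfNat_surjective b'
  obtain ⟨h, rfl⟩ := ratOfNat_surjective h'
  have hgrid : ∀ j : ℕ, (ratOfNat (gridC b h j) : ℝ) = ratOfNat b + j * ratOfNat h := fun j => by
    rw [ratOfNat_gridC]
    push_cast
    rfl
  have hl : (0 : ℝ) < l + 1 := by positivity
  have ht : ∀ j, ∃ t : List ℕ × ℕ × ℕ × ℕ, j < l →
      IsCellCert φ idx e n (gridC b h j) (gridC b h (j + 1)) t ∧
      μ.real (Set.Ioo ((ratOfNat b : ℝ) + j * ratOfNat h) (ratOfNat b + (j + 1) * ratOfNat h)) -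
        ε / (l + 1) < ratOfNat t.2.2.2 := by
    intro j
    by_cases hj : j < l
    swap
    · exact ⟨([], 0, 0, 0), fun h => absurd h hj⟩
    obtain ⟨⟨⟨ρ, k, v⟩, hρ, hv⟩, hsub⟩ := hcell j hj
    obtain ⟨m', hm1, hm2⟩ := exists_rat_btwn (sub_lt_self (μ.real (Set.Ioo
      ((ratOfNat b : ℝ) + j * ratOfNat h) (ratOfNat b + (j + 1) * ratOfNat h)))
      (show 0 < ε / (l + 1) by positivity))
    obtain ⟨m, rfl⟩ := ratOfNat_surjective m'
    have hget : ∀ i ≤ k, ((List.range (k + 1)).map ρ).getD i 0 = ρ i := fun i hi => by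
      simp [List.getD_eq_getElem?_getD, List.getElem?_range (Nat.lt_succ_iff.2 hi)]
    refine ⟨((List.range (k + 1)).map ρ, k, v, m), fun _ => ⟨⟨?_, ?_, ?_⟩, hm1⟩⟩
    · intro i hi
      dsimp only at hi ⊢
      rw [hget i hi.le, hget (i + 1) hi]
      exact hρ i hi
    · exact hv.congr fun i hi => (hget i hi.le).symm
    · dsimp only at hsub ⊢
      have hhR : (0 : ℝ) < ratOfNat h := by exact_mod_cast hh'
      have hsub' : Set.Ioo ((ratOfNat b : ℝ) + j * ratOfNat h) (ratOfNat b + (j + 1) * ratOfNat h) ⊆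
          Set.Ioo ((ratOfNat (ρ k) : ℝ) - (1 / 2) ^ k) (ratOfNat (ρ k) + (1 / 2) ^ k) := by
        intro y hy
        have : |(ratOfNat (ρ k) : ℝ) - y| < (1 / 2) ^ k := hsub hy
        rw [abs_lt] at this
        exact ⟨by linarith [this.2], by linarith [this.1]⟩
      rw [Set.Ioo_subset_Ioo_iff (by linarith)] at hsub'
      rw [hget k le_rfl, exists_dom_eval_iff hφ hidx, hgrid, hgrid, ← Rat.cast_le (K := ℝ),
        ← Rat.cast_le (K := ℝ), hgrid]
      push_cast
      refine ⟨hsub'.1, ?_, hm2⟩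
      rw [hgrid]
      push_cast
      exact hsub'.2
  choose t ht using ht
  have hgetD : ∀ j < l, ((List.range l).map t).getD j ([], 0, 0, 0) = t j := fun j hj => by
    simp [List.getD_eq_getElem?_getD, List.getElem?_range hj]
  refine ⟨(b, h, l, (List.range l).map t), by simpa [ratOfNat_natC] using hh', ?_, fun j hj => ?_⟩
  · dsimp only
    rw [ratOfNat_sumC, Finset.sum_congr rfl fun j hj => by rw [hgetD j (Finset.mem_range.1 hj)],
      ← Rat.cast_lt (K := ℝ), Rat.cast_sum]
    have h1 := Finset.sum_le_sum fun j hj => (ht j (Finset.mem_range.1 hj)).2.le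
    rw [Finset.sum_sub_distrib, Finset.sum_const, Finset.card_range, nsmul_eq_mul] at h1
    have h2 : (l : ℝ) * (ε / (l + 1)) ≤ ε := by
      rw [mul_div_assoc', div_le_iff₀ hl]
      nlinarith
    linarith
  · dsimp only
    rw [hgetD j hj]
    exact (ht j hj).1

end Correctness

/-- A computable measure has a computable integral on bounded nonnegative computable functions:
search for a grid certificate of sufficient precision. -/
theorem integralComputableOnBounded_of_isComputableMeasure (μ : Measure ℝ) [IsFiniteMeasure μ]
    (h : IsComputableMeasure μ) : IntegralComputableOnBounded μ := by
  obtain ⟨⟨c, ρ, hρc, hρ⟩, φ, hφ, hφμ⟩ := h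
  obtain ⟨idx, hidx, hidxI⟩ := exists_computable_isSigmaIndex
  have hρcomp : Computable ρ :=
    Partrec.of_eq_tot (Code.eval_part.comp (Computable.const c) Computable.id) hρc
  obtain ⟨M, hM⟩ := exists_nat_ge (μ.real Set.univ)
  -- `q K` codes a rational between `μ(ℝ) - 6 * 2 ^ (-K)` and `μ(ℝ) - 2 * 2 ^ (-K)`.
  obtain ⟨q, hq, hqval⟩ : ∃ q : ℕ → ℕ, Computable q ∧
      ∀ K, (ratOfNat (q K) : ℝ) = ratOfNat (ρ K) - 4 * (1 / 2) ^ K := by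
    have h1 : Primrec₂ fun r K : ℕ => addC r (negateC (mulC (natC 4) (halfPowC K))) :=
      primrec_addC Primrec.fst
        (primrec_negateC (primrec_mulC (Primrec.const _) (primrec_halfPowC Primrec.snd)))
    refine ⟨_, h1.to_comp.comp hρcomp Computable.id, fun K => ?_⟩
    simp only [id, ratOfNat_addC, ratOfNat_negateC, ratOfNat_mulC, ratOfNat_natC,
      ratOfNat_halfPowC]
    push_cast
    ring
  have hR : REPred fun x : ((Code × ℕ) × ℕ) × (ℕ × ℕ × ℕ × List (List ℕ × ℕ × ℕ × ℕ)) =>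
      IsGridCert φ idx x.1.1.1 (x.1.2 + (4 + M)) (q (x.1.2 + x.1.1.2 + 7)) x.2 := by
    have he : Primrec fun x : ((Code × ℕ) × ℕ) × (ℕ × ℕ × ℕ × List (List ℕ × ℕ × ℕ × ℕ)) =>
        x.1.1.1 := Primrec.fst.comp (Primrec.fst.comp Primrec.fst)
    have hB : Primrec fun x : ((Code × ℕ) × ℕ) × (ℕ × ℕ × ℕ × List (List ℕ × ℕ × ℕ × ℕ)) =>
        x.1.1.2 := Primrec.snd.comp (Primrec.fst.comp Primrec.fst)
    have hN : Primrec fun x : ((Code × ℕ) × ℕ) × (ℕ × ℕ × ℕ × List (List ℕ × ℕ × ℕ × ℕ)) =>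
        x.1.2 := Primrec.snd.comp Primrec.fst
    exact rePred_isGridCert hφ hidx he (Primrec.nat_add.comp hN (Primrec.const _))
      (hq.comp (Primrec.nat_add.comp (Primrec.nat_add.comp hN hB) (Primrec.const _)).to_comp)
      Primrec.snd
  obtain ⟨g, hg, hgR⟩ := exists_partrec_choice hR
  have hval : Computable₂ fun (_ : (Code × ℕ) × ℕ)
      (w : ℕ × ℕ × ℕ × List (List ℕ × ℕ × ℕ × ℕ)) => gridValueC w :=
    (primrec_gridValueC Primrec.snd).to_comp
  have hout : Partrec₂ fun (a : Code × ℕ) (N : ℕ) => (g (a, N)).map gridValueC :=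
    Partrec.map hg hval
  obtain ⟨ψ, hψ, hψg⟩ := exists_computable_code hout
  refine ⟨fun a => Part.some (ψ a), hψ.partrec, fun e f B he hf0 hfB =>
    ⟨ψ (e, B), Part.mem_some _, ?_⟩⟩
  have hqM : ∀ K, (ratOfNat (q K) : ℝ) < μ.real Set.univ := fun K => by
    have h1 := (abs_le.1 (hρ.abs_sub_le K)).2
    have h2 : (0 : ℝ) < (1 / 2) ^ K := by positivity
    rw [hqval]
    linarith
  have hw : ∀ N, ∃ w ∈ g ((e, B), N), IsGridCert φ idx e (N + (4 + M)) (q (N + B + 7)) w := by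
    intro N
    have hex := exists_isGridCert hφμ hidxI he (N + (4 + M)) (hqM (N + B + 7))
    exact hgR ((e, B), N) hex
  choose w hwg hw using hw
  refine ⟨fun N => gridValueC (w N), fun N => ?_, isCauchyName_of_abs_sub_le fun N => ?_⟩
  · rw [hψg]
    exact Part.mem_map _ (hwg N)
  · have hfB' : ∀ x, f x ≤ B := fun x => (le_abs_self _).trans (hfB x)
    refine ((hw N).abs_sub_integral_le hφμ hidxI he hf0 hfB').trans ?_
    have hpN : (0 : ℝ) < (1 / 2) ^ N := by positivity
    -- `M ≤ 2 ^ M` and `B + 1 ≤ 2 ^ B` make the two error terms small.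
    have h1 : (2 : ℝ) * (1 / 2) ^ (N + (4 + M)) * μ.real Set.univ ≤ (1 / 2) ^ N / 8 := by
      have hM2 : μ.real Set.univ ≤ 2 ^ M := hM.trans (by exact_mod_cast Nat.lt_two_pow_self.le)
      calc (2 : ℝ) * (1 / 2) ^ (N + (4 + M)) * μ.real Set.univ
          ≤ 2 * (1 / 2) ^ (N + (4 + M)) * 2 ^ M := by gcongr
        _ = (1 / 2) ^ N / 8 * ((1 / 2) ^ M * 2 ^ M) := by ring
        _ = (1 / 2) ^ N / 8 := by rw [← mul_pow]; norm_num
    have h2 : μ.real Set.univ - ratOfNat (q (N + B + 7)) ≤ 8 * (1 / 2) ^ (N + B + 7) := by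
      have h3 := (abs_le.1 (hρ.abs_sub_le (N + B + 7))).1
      have h4 : (0 : ℝ) < (1 / 2) ^ (N + B + 7) := by positivity
      rw [hqval]
      linarith
    have h5 : (B : ℝ) + 2 * (1 / 2) ^ (N + (4 + M)) ≤ 2 ^ B := by
      have h6 : (B : ℝ) + 1 ≤ 2 ^ B := by exact_mod_cast Nat.lt_two_pow_self
      have h7 : (1 / 2 : ℝ) ^ (N + (4 + M)) ≤ (1 / 2) ^ 1 :=
        pow_le_pow_of_le_one (by norm_num) (by norm_num) (by omega)
      linarith
    have h8 : ((B : ℝ) + 2 * (1 / 2) ^ (N + (4 + M))) *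
        (μ.real Set.univ - ratOfNat (q (N + B + 7))) ≤ (1 / 2) ^ N / 16 := by
      calc _ ≤ (2 : ℝ) ^ B * (8 * (1 / 2) ^ (N + B + 7)) :=
            mul_le_mul h5 h2 (sub_nonneg.2 (hqM _).le) (by positivity)
        _ = (1 / 2) ^ N / 16 * ((1 / 2) ^ B * 2 ^ B) := by ring
        _ = (1 / 2) ^ N / 16 := by rw [← mul_pow]; norm_num
    have h9 : (1 / 2 : ℝ) ^ (N + 2) = (1 / 2) ^ N / 4 := by ring
    rw [h9]
    linarith

theorem integralComputableOnUnifCont_of_integralComputableOnBounded (μ : Measure ℝ)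
    (h : IntegralComputableOnBounded μ) : IntegralComputableOnUnifCont μ := by
  obtain ⟨φ, hφ, hφμ⟩ := h
  refine ⟨fun e => φ (e, 1), hφ.comp (Computable.id.pair (Computable.const 1)),
    fun e f he _ hf => hφμ e f 1 he (fun x => (hf x).1) fun x => ?_⟩
  rw [abs_of_nonneg (hf x).1]
  simpa using (hf x).2

end CompMeasure

theorem proposition3p2 (μ : MeasureTheory.Measure ℝ) [MeasureTheory.IsFiniteMeasure μ] :
    List.TFAE
      [CompMeasure.IsComputableMeasure μ,
       CompMeasure.IntegralComputableOnBounded μ,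
       CompMeasure.IntegralComputableOnUnifCont μ] := by
  tfae_have 1 → 2 := CompMeasure.integralComputableOnBounded_of_isComputableMeasure μ
  tfae_have 2 → 3 := CompMeasure.integralComputableOnUnifCont_of_integralComputableOnBounded μ
  tfae_have 3 → 1 := CompMeasure.isComputableMeasure_of_integralComputableOnUnifCont μ
  tfae_finish
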